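/- For $S_1\in\mathbb R^{m_1\times n_1}$ and $S_2\in\mathbb R^{m_2\times n_2}$, the 1-product $S_1\otimes S_2\in\mathbb R^{(m_1+m_2)\times(n_1n_2)}$ is the matrix whose column with index $(k-1)n_2+\ell$ (where $1\le k\le n_1$, $1\le \ell\le n_2$) is the $k$-th column of $S_1$ stacked on top of the $\ell$-th column of $S_2$. Two matrices are isomorphic if one can be obtained from the other by permuting rows and columns. A matrix $S$ is a 1-product if it is isomorphic to $S_1\otimes S_2$ for some non-empty matrices $S_1,S_2$, that is, matrices with at least one row and at least one column. Theorem. There is an algorithm, namely a single real RAM program (using the constants $0,1$, exact real arithmetic $+,-,\cdot,/$ and comparisons of reals at unit cost, and natural-number indices with addition, truncated subtraction, comparison and indirect addressing, without any conversion of reals to natural numbers), and a polynomial $p$ in two variables such that, for all $m,n$, given any $S\in\mathbb R^{m\times n}$, the program halts after at most $p(m,n)$ steps, correctly determines whether $S$ is a 1-product, and, in case it is, outputs two non-empty matrices $S_1,S_2$ such that $S_1\otimes S_2$ is isomorphic to $S$. -/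

import Mathlib

/-! ### The 1-product of matrices -/

/-- The 1-product: column `k * n₂ + l` (0-based) is column `k` of `S₁` on top of column `l`
of `S₂`. -/
def oneProd {m₁ n₁ m₂ n₂ : ℕ} (S₁ : Matrix (Fin m₁) (Fin n₁) ℝ)
    (S₂ : Matrix (Fin m₂) (Fin n₂) ℝ) : Matrix (Fin (m₁ + m₂)) (Fin (n₁ * n₂)) ℝ :=
  Matrix.of fun i j =>
    Fin.addCases (fun i₁ => S₁ i₁ j.divNat) (fun i₂ => S₂ i₂ j.modNat) i

/-- Two matrices are isomorphic if one is obtained from the other by permuting rows and columns.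
The sizes are allowed to differ as expressions; the two bijections force them to be equal. -/
def MatIso {m n m' n' : ℕ} (A : Matrix (Fin m) (Fin n) ℝ) (B : Matrix (Fin m') (Fin n') ℝ) :
    Prop :=
  ∃ (e : Fin m ≃ Fin m') (f : Fin n ≃ Fin n'), ∀ i j, A i j = B (e i) (f j)

/-- `S` is a 1-product: it is isomorphic to `S₁ ⊗ S₂` for two non-empty matrices (matrices with
at least one row and at least one column). -/
def IsOneProduct {m n : ℕ} (S : Matrix (Fin m) (Fin n) ℝ) : Prop :=
  ∃ (m₁ n₁ m₂ n₂ : ℕ) (S₁ : Matrix (Fin m₁) (Fin n₁) ℝ) (S₂ : Matrix (Fin m₂) (Fin n₂) ℝ),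
    0 < m₁ ∧ 0 < n₁ ∧ 0 < m₂ ∧ 0 < n₂ ∧ MatIso S (oneProd S₁ S₂)

/-! ### Real RAM programs with a step count

A program is a finite text acting on an unbounded memory which holds natural numbers and real
numbers. Natural numbers serve for counting and for addressing; the only operations on them are
addition, truncated subtraction and comparison, so that within `t` steps only numbers of `O(t)`
more bits than the initial ones can be produced. On real numbers there are exact field operations
and comparison, at unit cost; the only constants are `0` and `1`, and there is no rounding and no
conversion from real numbers to natural numbers. Every operation, memory access, assignment and
test is charged. -/

namespace RealRAM

/-- The memory. Variables and arrays are named by natural numbers, which are fixed in the text of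
a program; array cells are addressed by pairs of natural numbers, which a program can compute. -/
structure State where
  /-- natural-number variables -/
  var : ℕ → ℕ
  /-- natural-number arrays: name, row index, column index -/
  arr : ℕ → ℕ → ℕ → ℕ
  /-- real variables -/
  rvar : ℕ → ℝ
  /-- real arrays: name, row index, column index -/
  rarr : ℕ → ℕ → ℕ → ℝ

/-- Natural-number expressions. -/
inductive NExp where
  | const (c : ℕ)
  | var (x : ℕ)
  | get (a : ℕ) (i j : NExp)
  | add (e f : NExp)
  | sub (e f : NExp)

/-- The value of a natural-number expression (`sub` is truncated subtraction). -/
def NExp.eval (s : State) : NExp → ℕ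
  | .const c => c
  | .var x => s.var x
  | .get a i j => s.arr a (i.eval s) (j.eval s)
  | .add e f => e.eval s + f.eval s
  | .sub e f => e.eval s - f.eval s

/-- The cost of evaluating a natural-number expression: its number of nodes. -/
def NExp.cost : NExp → ℕ
  | .const _ => 1
  | .var _ => 1
  | .get _ i j => i.cost + j.cost + 1
  | .add e f => e.cost + f.cost + 1
  | .sub e f => e.cost + f.cost + 1

/-- Real expressions. -/
inductive RExp where
  | zero
  | one
  | var (x : ℕ)
  | get (a : ℕ) (i j : NExp)
  | add (e f : RExp)
  | sub (e f : RExp)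
  | mul (e f : RExp)
  | div (e f : RExp)

/-- The value of a real expression (division by zero returns `0`). -/
noncomputable def RExp.eval (s : State) : RExp → ℝ
  | .zero => 0
  | .one => 1
  | .var x => s.rvar x
  | .get a i j => s.rarr a (i.eval s) (j.eval s)
  | .add e f => e.eval s + f.eval s
  | .sub e f => e.eval s - f.eval s
  | .mul e f => e.eval s * f.eval s
  | .div e f => e.eval s / f.eval s

/-- The cost of evaluating a real expression: its number of nodes. -/
def RExp.cost : RExp → ℕ
  | .zero => 1
  | .one => 1
  | .var _ => 1
  | .get _ i j => i.cost + j.cost + 1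
  | .add e f => e.cost + f.cost + 1
  | .sub e f => e.cost + f.cost + 1
  | .mul e f => e.cost + f.cost + 1
  | .div e f => e.cost + f.cost + 1

/-- Tests: comparisons of natural numbers and of real numbers, and Boolean combinations. -/
inductive Test where
  | nle (e f : NExp)
  | neq (e f : NExp)
  | rle (e f : RExp)
  | req (e f : RExp)
  | not (b : Test)
  | and (b c : Test)

/-- The outcome of a test. In the names, `nle` and `neq` are `≤` and `=` of natural numbers, and
`rle` and `req` are `≤` and `=` of real numbers. -/
def Test.Holds (s : State) : Test → Prop
  | .nle e f => e.eval s ≤ f.eval s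
  | .neq e f => e.eval s = f.eval s
  | .rle e f => e.eval s ≤ f.eval s
  | .req e f => e.eval s = f.eval s
  | .not b => ¬ b.Holds s
  | .and b c => b.Holds s ∧ c.Holds s

/-- The cost of a test. -/
def Test.cost : Test → ℕ
  | .nle e f => e.cost + f.cost + 1
  | .neq e f => e.cost + f.cost + 1
  | .rle e f => e.cost + f.cost + 1
  | .req e f => e.cost + f.cost + 1
  | .not b => b.cost + 1
  | .and b c => b.cost + c.cost + 1

/-- Programs. -/
inductive Program where
  | skip
  /-- `x := e` for a natural-number variable -/
  | set (x : ℕ) (e : NExp)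
  /-- `a[i, j] := e` for a natural-number array -/
  | put (a : ℕ) (i j e : NExp)
  /-- `x := e` for a real variable -/
  | rset (x : ℕ) (e : RExp)
  /-- `a[i, j] := e` for a real array -/
  | rput (a : ℕ) (i j : NExp) (e : RExp)
  | seq (p q : Program)
  | ite (b : Test) (p q : Program)
  | while (b : Test) (p : Program)

/-- Writing a natural number into a variable. -/
def State.setVar (s : State) (x v : ℕ) : State :=
  { s with var := fun y => if y = x then v else s.var y }

/-- Writing a natural number into an array cell. -/
def State.setArr (s : State) (a i j v : ℕ) : State :=
  { s with arr := fun b k l => if b = a ∧ k = i ∧ l = j then v else s.arr b k l }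

/-- Writing a real number into a variable. -/
noncomputable def State.setRVar (s : State) (x : ℕ) (v : ℝ) : State :=
  { s with rvar := fun y => if y = x then v else s.rvar y }

/-- Writing a real number into an array cell. -/
noncomputable def State.setRArr (s : State) (a i j : ℕ) (v : ℝ) : State :=
  { s with rarr := fun b k l => if b = a ∧ k = i ∧ l = j then v else s.rarr b k l }

/-- `Exec p s t s'`: started in the memory `s`, the program `p` halts after exactly `t` steps with
the memory `s'`. Execution is deterministic; a program that runs forever has no such `t`, `s'`. -/
inductive Exec : Program → State → ℕ → State → Prop where
  | skip (s : State) : Exec .skip s 1 s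
  | set (s : State) (x : ℕ) (e : NExp) :
      Exec (.set x e) s (e.cost + 1) (s.setVar x (e.eval s))
  | put (s : State) (a : ℕ) (i j e : NExp) :
      Exec (.put a i j e) s (i.cost + j.cost + e.cost + 1)
        (s.setArr a (i.eval s) (j.eval s) (e.eval s))
  | rset (s : State) (x : ℕ) (e : RExp) :
      Exec (.rset x e) s (e.cost + 1) (s.setRVar x (e.eval s))
  | rput (s : State) (a : ℕ) (i j : NExp) (e : RExp) :
      Exec (.rput a i j e) s (i.cost + j.cost + e.cost + 1)
        (s.setRArr a (i.eval s) (j.eval s) (e.eval s))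
  | seq {p q : Program} {s s' s'' : State} {t t' : ℕ} :
      Exec p s t s' → Exec q s' t' s'' → Exec (.seq p q) s (t + t') s''
  | iteTrue {b : Test} {p q : Program} {s s' : State} {t : ℕ} :
      b.Holds s → Exec p s t s' → Exec (.ite b p q) s (b.cost + t) s'
  | iteFalse {b : Test} {p q : Program} {s s' : State} {t : ℕ} :
      ¬ b.Holds s → Exec q s t s' → Exec (.ite b p q) s (b.cost + t) s'
  | whileFalse {b : Test} {p : Program} {s : State} :
      ¬ b.Holds s → Exec (.while b p) s b.cost s
  | whileTrue {b : Test} {p : Program} {s s' s'' : State} {t t' : ℕ} :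
      b.Holds s → Exec p s t s' → Exec (.while b p) s' t' s'' →
      Exec (.while b p) s (b.cost + t + t') s''

/-- The initial memory for an input matrix: the natural-number variables `0` and `1` hold the
numbers of rows and columns, the real array `0` holds the entries (indices start at `0`), and
everything else is `0`. -/
noncomputable def input {m n : ℕ} (S : Matrix (Fin m) (Fin n) ℝ) : State where
  var := fun x => if x = 0 then m else if x = 1 then n else 0
  arr := fun _ _ _ => 0
  rvar := fun _ => 0
  rarr := fun a i j => if h : a = 0 ∧ i < m ∧ j < n then S ⟨i, h.2.1⟩ ⟨j, h.2.2⟩ else 0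

/-- The `m × n` matrix in the top left corner of the real array `a`. -/
def State.matrix (s : State) (a m n : ℕ) : Matrix (Fin m) (Fin n) ℝ :=
  Matrix.of fun i j => s.rarr a i j

end RealRAM

/-- The memory `s` holds a correct answer for `S`. The natural-number variable `0` holds `1` if `S`
is a 1-product and `0` if it is not. If it is one, then moreover the variables `1`, `2` hold the
size of a non-empty matrix stored in the real array `1`, the variables `3`, `4` hold the size of a
non-empty matrix stored in the real array `2`, and the 1-product of these is isomorphic to `S`. -/
def CorrectAnswer {m n : ℕ} (S : Matrix (Fin m) (Fin n) ℝ) (s : RealRAM.State) : Prop :=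
  (¬ IsOneProduct S → s.var 0 = 0) ∧
  (IsOneProduct S → s.var 0 = 1 ∧
    0 < s.var 1 ∧ 0 < s.var 2 ∧ 0 < s.var 3 ∧ 0 < s.var 4 ∧
    MatIso S (oneProd (s.matrix 1 (s.var 1) (s.var 2)) (s.matrix 2 (s.var 3) (s.var 4))))

/-! Call a set of rows split off if, for a uniformly random column, the part of the column in these
rows is independent of the rest. The rows of a factor of a 1-product split off. Conversely, let `A`
split off, and let `f` and `g` be the multiplicities of some part in `A` and of some part in the
other rows. Independence makes `f * g` a multiple of the number `n` of columns, so the gcd `d` of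
all the `f` and `e = n / d` satisfy `d ∣ f` and `e ∣ g` throughout, and factors are obtained by
keeping one in `d` of the equal parts in `A` and one in `e` of the equal other parts.

Hence it suffices to find the least set that contains the first row and splits off. It can be grown
greedily: if `A` lies in a set `Z` that splits off, and `A` is independent of some other rows `T`
but not of `T` and `r` together, then `r ∈ Z`, by the contraction property of independence. The
number `d` is found by trial. -/

/-! ### Selecting a fixed proportion of each fibre -/

section Counting

variable {γ : Type*} [DecidableEq γ] {c : ℕ → γ} {d n : ℕ}

theorem count_congr_of_lt {p q : ℕ → Prop} [DecidablePred p] [DecidablePred q]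
    (h : ∀ x < n, (p x ↔ q x)) : n.count p = n.count q := by
  rw [Nat.count_eq_card_filter_range, Nat.count_eq_card_filter_range]
  exact congrArg _ (Finset.filter_congr fun x hx => h x (Finset.mem_range.1 hx))

theorem count_count (p q : ℕ → Prop) [DecidablePred p] [DecidablePred q] (n : ℕ) :
    (n.count p).count q = n.count fun x => p x ∧ q (x.count p) := by
  induction n with
  | zero => simp
  | succ n ih => by_cases hp : p n <;> simp [Nat.count_succ, hp, ih]

theorem le_count_dvd_mul (hd : 0 < d) (k : ℕ) : k ≤ k.count (d ∣ ·) * d := by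
  induction k with
  | zero => simp
  | succ k ih =>
    rw [Nat.count_succ, add_mul]
    split_ifs with hk
    · omega
    · have : k ≠ k.count (d ∣ ·) * d := fun h => hk (h ▸ dvd_mul_left _ _)
      omega

theorem count_dvd_mul_eq_iff (hd : 0 < d) {k : ℕ} : k.count (d ∣ ·) * d = k ↔ d ∣ k := by
  refine ⟨fun h => h ▸ dvd_mul_left _ _, ?_⟩
  rintro ⟨q, rfl⟩
  have h := Nat.count_modEq_card (d * q) hd 0
  simp only [Nat.modEq_zero_iff_dvd, Nat.zero_mod, Nat.mul_mod_right, lt_self_iff_false,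
    if_false, add_zero, Nat.mul_div_cancel_left q hd] at h
  rw [h, mul_comm]

theorem sum_count_fiber (p : ℕ → Prop) [DecidablePred p] (c : ℕ → γ) (n : ℕ) :
    ∑ u ∈ (Finset.range n).image c, n.count (fun x => c x = u ∧ p x) = n.count p := by
  rw [Nat.count_eq_card_filter_range, Finset.card_eq_sum_card_fiberwise (f := c)
    (t := (Finset.range n).image c)
    fun x hx => Finset.mem_image_of_mem c (Finset.mem_filter.1 hx).1]
  refine Finset.sum_congr rfl fun u _ => ?_
  rw [Nat.count_eq_card_filter_range, Finset.filter_filter]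
  simp only [and_comm]

/-- In each fibre of the colouring `c`, every `d`-th number is selected, beginning with the
first. -/
def Selected (c : ℕ → γ) (d x : ℕ) : Prop := d ∣ x.count fun y => c y = c x

instance (c : ℕ → γ) (d : ℕ) : DecidablePred (Selected c d) := fun _ => Nat.decidable_dvd _ _

theorem count_fiber_selected (c : ℕ → γ) (d : ℕ) (u : γ) (n : ℕ) :
    n.count (fun x => c x = u ∧ Selected c d x) = (n.count fun x => c x = u).count (d ∣ ·) := by
  rw [count_count]
  refine count_congr_of_lt fun x _ => and_congr_right ?_
  rintro rfl
  rfl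

theorem count_selected_mul_eq_iff (hd : 0 < d) :
    n.count (Selected c d) * d = n ↔ ∀ u, d ∣ n.count fun x => c x = u := by
  have hsum : ∑ u ∈ (Finset.range n).image c, n.count (fun x => c x = u) = n := by
    simpa using sum_count_fiber (fun _ => True) c n
  have hle (u : γ) : n.count (fun x => c x = u) ≤
      n.count (fun x => c x = u ∧ Selected c d x) * d := by
    rw [count_fiber_selected]
    exact le_count_dvd_mul hd _
  have hiff (u : γ) : n.count (fun x => c x = u) =
      n.count (fun x => c x = u ∧ Selected c d x) * d ↔ d ∣ n.count fun x => c x = u := by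
    rw [count_fiber_selected, eq_comm, count_dvd_mul_eq_iff hd]
  rw [← sum_count_fiber (Selected c d) c n, Finset.sum_mul, eq_comm]
  nth_rw 1 [← hsum]
  rw [Finset.sum_eq_sum_iff_of_le fun u _ => hle u]
  refine ⟨fun h u => ?_, fun h u _ => (hiff u).2 (h u)⟩
  by_cases hu : u ∈ (Finset.range n).image c
  · exact (hiff u).1 (h u hu)
  · have : n.count (fun x => c x = u) = 0 := Nat.count_iff_forall_not.2 fun x hx hxu =>
      hu (hxu ▸ Finset.mem_image_of_mem c (Finset.mem_range.2 hx))
    exact this ▸ dvd_zero d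

theorem count_fiber_selected_mul (hd : 0 < d) (h : n.count (Selected c d) * d = n) (u : γ) :
    n.count (fun x => c x = u ∧ Selected c d x) * d = n.count fun x => c x = u := by
  rw [count_fiber_selected, count_dvd_mul_eq_iff hd]
  exact (count_selected_mul_eq_iff hd).1 h u

end Counting

/-! ### Independent sets of rows -/

section Independence

variable {ι κ α : Type*} [DecidableEq α]

/-- The number of columns of `M` with index in `s` that agree with `z` in the rows `A`. -/
def colCount (M : Matrix ι κ α) (s : Finset κ) (A : Finset ι) (z : ι → α) : ℕ :=
  (s.filter fun x => ∀ i ∈ A, M i x = z i).card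

variable {M : Matrix ι κ α} {s : Finset κ} {A B C D T Z R : Finset ι} {z w : ι → α}

theorem colCount_congr (h : ∀ i ∈ A, z i = w i) : colCount M s A z = colCount M s A w := by
  refine congrArg Finset.card (Finset.filter_congr fun _ _ => forall₂_congr fun i hi => ?_)
  rw [h i hi]

theorem colCount_empty : colCount M s ∅ z = s.card := by simp [colCount]

theorem colCount_anti (h : A ⊆ B) : colCount M s B z ≤ colCount M s A z :=
  Finset.card_le_card (Finset.monotone_filter_right _ fun _ _ hx i hi => hx i (h hi))

theorem colCount_pos : 0 < colCount M s A z ↔ ∃ x ∈ s, ∀ i ∈ A, M i x = z i := by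
  simp [colCount, Finset.card_pos, Finset.filter_nonempty_iff]

theorem colCount_map {ι' κ' : Type*} {M' : Matrix ι' κ' α} {e : ι ↪ ι'} {f : κ ↪ κ'}
    (hM : ∀ i x, M' (e i) (f x) = M i x) (z : ι' → α) :
    colCount M' (s.map f) (A.map e) z = colCount M s A (z ∘ e) := by
  rw [colCount, Finset.filter_map, Finset.card_map]
  exact congrArg Finset.card (Finset.filter_congr fun x _ => by simp [hM])

variable [DecidableEq ι]

open Classical in
theorem colCount_eq_sum (h : Disjoint A D) : colCount M s A z =
    ∑ w ∈ s.image fun x => D.piecewise (M · x) z, colCount M s (A ∪ D) w := by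
  rw [colCount, Finset.card_eq_sum_card_fiberwise (f := fun x => D.piecewise (M · x) z)
    fun x hx => Finset.mem_image_of_mem _ (Finset.mem_filter.1 hx).1]
  refine Finset.sum_congr rfl fun w hw => ?_
  obtain ⟨y, -, rfl⟩ := Finset.mem_image.1 hw
  rw [colCount, Finset.filter_filter]
  refine congrArg _ (Finset.filter_congr fun x _ => ?_)
  rw [Finset.forall_mem_union]
  refine and_congr (forall₂_congr fun i hi => ?_) ?_
  · rw [Finset.piecewise_eq_of_notMem _ _ _ (Finset.disjoint_left.1 h hi)]
  · constructor
    · intro h i hi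
      simpa [hi] using congrFun h i
    · intro h
      exact D.piecewise_congr (fun i hi => by simpa [hi] using h i hi) fun _ _ => rfl

/-- The parts in the rows `A` and in the rows `B` of a random column of `M`, uniform among those
with index in `s`, are independent. The condition is multiplied out, so as to be about natural
numbers. -/
def RowIndep (M : Matrix ι κ α) (s : Finset κ) (A B : Finset ι) : Prop :=
  ∀ z, colCount M s (A ∪ B) z * s.card = colCount M s A z * colCount M s B z

namespace RowIndep

theorem symm (h : RowIndep M s A B) : RowIndep M s B A := fun z => by
  rw [Finset.union_comm, h z, mul_comm]

theorem empty_right : RowIndep M s A ∅ := fun z => by rw [Finset.union_empty, colCount_empty]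

theorem mono_right (h : RowIndep M s A B) (hAB : Disjoint A B) (hC : C ⊆ B) :
    RowIndep M s A C := by
  classical
  intro z
  have hAD : Disjoint A (B \ C) := hAB.mono_right Finset.sdiff_subset
  have hCD : Disjoint C (B \ C) := Finset.disjoint_sdiff
  rw [colCount_eq_sum (Finset.disjoint_union_left.2 ⟨hAD, hCD⟩), colCount_eq_sum hCD,
    Finset.sum_mul, Finset.mul_sum]
  refine Finset.sum_congr rfl fun w hw => ?_
  obtain ⟨x, -, rfl⟩ := Finset.mem_image.1 hw
  rw [Finset.union_assoc, Finset.union_sdiff_of_subset hC, h, colCount_congr (A := A) (w := z)]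
  exact fun i hi => Finset.piecewise_eq_of_notMem _ _ _ (Finset.disjoint_left.1 hAD hi)

theorem mono (h : RowIndep M s A B) (hAB : Disjoint A B) (hC : C ⊆ A) (hT : T ⊆ B) :
    RowIndep M s C T :=
  ((h.mono_right hAB hT).symm.mono_right (hAB.mono_right hT).symm hC).symm

theorem contract (h₁ : RowIndep M s A B) (h₂ : RowIndep M s (A ∪ B) C)
    (hd : Disjoint (A ∪ B) C) : RowIndep M s A (B ∪ C) := by
  intro z
  have h₃ : RowIndep M s B C := h₂.mono hd Finset.subset_union_right subset_rfl
  obtain hs | hs := s.card.eq_zero_or_pos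
  · have hle : colCount M s A z ≤ 0 :=
      hs ▸ colCount_empty (M := M) ▸ colCount_anti (Finset.empty_subset A)
    rw [hs, Nat.le_zero.1 hle, mul_zero, zero_mul]
  refine Nat.eq_of_mul_eq_mul_right hs ?_
  rw [← Finset.union_assoc, h₂ z, mul_right_comm, h₁ z, mul_assoc, mul_assoc, h₃ z]

theorem map {ι' κ' : Type*} [DecidableEq ι'] {M' : Matrix ι' κ' α} {e : ι ↪ ι'} {f : κ ↪ κ'}
    (hM : ∀ i x, M' (e i) (f x) = M i x) (h : RowIndep M s A B) :
    RowIndep M' (s.map f) (A.map e) (B.map e) := by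
  intro z
  rw [← Finset.map_union, colCount_map hM, colCount_map hM, colCount_map hM, Finset.card_map, h]

end RowIndep

theorem rowIndep_iff (hAB : Disjoint A B) : RowIndep M s A B ↔ ∀ a ∈ s, ∀ b ∈ s,
    (s.filter fun x => (∀ i ∈ A, M i x = M i a) ∧ ∀ i ∈ B, M i x = M i b).card * s.card =
      colCount M s A (M · a) * colCount M s B (M · b) := by
  have key {a b : κ} {z : ι → α} (ha : ∀ i ∈ A, M i a = z i) (hb : ∀ i ∈ B, M i b = z i) :
      (s.filter fun x => (∀ i ∈ A, M i x = M i a) ∧ ∀ i ∈ B, M i x = M i b).card =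
        colCount M s (A ∪ B) z := by
    refine congrArg _ (Finset.filter_congr fun x _ => ?_)
    rw [Finset.forall_mem_union]
    exact and_congr (forall₂_congr fun i hi => by rw [ha i hi])
      (forall₂_congr fun i hi => by rw [hb i hi])
  constructor
  · intro h a _ b _
    have ha : ∀ i ∈ A, M i a = A.piecewise (M · a) (M · b) i := fun i hi => by simp [hi]
    have hb : ∀ i ∈ B, M i b = A.piecewise (M · a) (M · b) i := fun i hi => by
      simp [Finset.disjoint_right.1 hAB hi]
    rw [key ha hb, h, colCount_congr ha, colCount_congr hb]
  · intro h z
    obtain hA | hA := (colCount M s A z).eq_zero_or_pos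
    · rw [Nat.le_zero.1 ((colCount_anti Finset.subset_union_left).trans_eq hA), hA,
        zero_mul, zero_mul]
    obtain hB | hB := (colCount M s B z).eq_zero_or_pos
    · rw [Nat.le_zero.1 ((colCount_anti Finset.subset_union_right).trans_eq hB), hB,
        zero_mul, mul_zero]
    obtain ⟨a, has, ha⟩ := colCount_pos.1 hA
    obtain ⟨b, hbs, hb⟩ := colCount_pos.1 hB
    rw [← key ha hb, h a has b hbs, colCount_congr ha, colCount_congr hb]

/-- The rows `Z` are independent of the other rows in `R`. -/
def SplitsOff (M : Matrix ι κ α) (s : Finset κ) (R Z : Finset ι) : Prop :=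
  Z ⊆ R ∧ RowIndep M s Z (R \ Z)

theorem SplitsOff.mem_of_not_insert {r : ι} (hZ : SplitsOff M s R Z) (hAZ : A ⊆ Z) (hTR : T ⊆ R)
    (hrR : r ∈ R) (hAT : Disjoint A T) (h : RowIndep M s A T)
    (hr : ¬ RowIndep M s A (insert r T)) : r ∈ Z := by
  by_contra hrZ
  refine hr ?_
  have hsplit : insert r T = (T ∩ Z) ∪ (insert r T \ Z) := by
    ext j
    by_cases hj : j ∈ Z
    · have : j ≠ r := fun e => hrZ (e ▸ hj)
      simp [hj, this]
    · simp [hj]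
  have hd : Disjoint Z (R \ Z) := Finset.disjoint_sdiff
  have hZ' : A ∪ T ∩ Z ⊆ Z := Finset.union_subset hAZ Finset.inter_subset_right
  have hR' : insert r T \ Z ⊆ R \ Z :=
    Finset.sdiff_subset_sdiff (Finset.insert_subset hrR hTR) subset_rfl
  rw [hsplit]
  exact (h.mono_right hAT Finset.inter_subset_left).contract (hZ.2.mono hd hZ' hR')
    (hd.mono hZ' hR')

/-- If the part in `A` of each column determines `f` columns and the part in `B` determines `g`
columns, then `#s ∣ f * g` for all the occurring pairs; take for `d` the gcd of all `f`. -/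
theorem RowIndep.exists_mul_eq_card (h : RowIndep M s A B) (hAB : Disjoint A B)
    (hs : s.Nonempty) : ∃ d e, d * e = s.card ∧
      (∀ z, d ∣ colCount M s A z) ∧ ∀ z, e ∣ colCount M s B z := by
  have hocc {C : Finset ι} {d : ℕ} (hd : ∀ x ∈ s, d ∣ colCount M s C (M · x)) (z : ι → α) :
      d ∣ colCount M s C z := by
    obtain hz | hz := (colCount M s C z).eq_zero_or_pos
    · exact hz ▸ dvd_zero d
    · obtain ⟨x, hx, hxz⟩ := colCount_pos.1 hz
      exact colCount_congr hxz ▸ hd x hx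
  have hdvd : ∀ x ∈ s, ∀ y ∈ s,
      s.card ∣ colCount M s A (M · x) * colCount M s B (M · y) := fun x hx y hy =>
    (rowIndep_iff hAB).1 h x hx y hy ▸ dvd_mul_left _ _
  obtain ⟨x, hx⟩ := hs
  set d := s.gcd fun x => colCount M s A (M · x)
  have hdA : ∀ z, d ∣ colCount M s A z := hocc fun x hx => Finset.gcd_dvd hx
  obtain ⟨e, he⟩ : d ∣ s.card := by
    classical
    rw [← colCount_empty (M := M) (z := (M · x)), colCount_eq_sum (Finset.disjoint_empty_left A),
      Finset.empty_union]
    exact Finset.dvd_sum fun w _ => hdA w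
  refine ⟨d, e, he.symm, hdA, hocc fun y hy => ?_⟩
  have hd : 0 < d := Nat.pos_of_mul_pos_right (he ▸ Finset.card_pos.2 ⟨x, hx⟩)
  refine Nat.dvd_of_mul_dvd_mul_left hd ?_
  rw [← he, ← normalize_eq (colCount M s B _), ← Finset.gcd_mul_right]
  exact Finset.dvd_gcd fun x hx => hdvd x hx y hy

/-- On the rows `A`, each column of `M` with index in `s` occurs `d` times as often as among the
columns of `N` with index in `t`. -/
def IsThinning {κ' : Type*} (N : Matrix ι κ' α) (t : Finset κ') (M : Matrix ι κ α) (s : Finset κ)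
    (A : Finset ι) (d : ℕ) : Prop :=
  ∀ z, colCount N t A z * d = colCount M s A z

theorem RowIndep.colCount_union {κ₁ κ₂ : Type*} {N₁ : Matrix ι κ₁ α} {N₂ : Matrix ι κ₂ α}
    {t₁ : Finset κ₁} {t₂ : Finset κ₂} {d e : ℕ} (h : RowIndep M s A B)
    (h₁ : IsThinning N₁ t₁ M s A d) (h₂ : IsThinning N₂ t₂ M s B e) (hde : d * e = s.card)
    (hs : s.Nonempty) :
    colCount M s (A ∪ B) z = colCount N₁ t₁ A z * colCount N₂ t₂ B z := by
  refine Nat.eq_of_mul_eq_mul_right (Finset.card_pos.2 hs) ?_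
  rw [h, ← h₁, ← h₂, ← hde]
  ring

end Independence

section OneProduct

open Finset (range univ)

variable {m n m₁ n₁ m₂ n₂ : ℕ}

section

variable (S₁ : Matrix (Fin m₁) (Fin n₁) ℝ) (S₂ : Matrix (Fin m₂) (Fin n₂) ℝ)

theorem oneProd_castAdd (i : Fin m₁) (j : Fin (n₁ * n₂)) :
    oneProd S₁ S₂ (Fin.castAdd m₂ i) j = S₁ i j.divNat := by
  simp [oneProd]

theorem oneProd_natAdd (i : Fin m₂) (j : Fin (n₁ * n₂)) :
    oneProd S₁ S₂ (Fin.natAdd m₁ i) j = S₂ i j.modNat := by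
  simp [oneProd]

theorem colCount_oneProd (A₁ : Finset (Fin m₁)) (A₂ : Finset (Fin m₂)) (z : Fin (m₁ + m₂) → ℝ) :
    colCount (oneProd S₁ S₂) univ (A₁.map (Fin.castAddEmb m₂) ∪ A₂.map (Fin.natAddEmb m₁)) z =
      colCount S₁ univ A₁ (z ∘ Fin.castAdd m₂) * colCount S₂ univ A₂ (z ∘ Fin.natAdd m₁) := by
  rw [colCount, colCount, colCount, ← Finset.card_product]
  refine Finset.card_equiv finProdFinEquiv.symm fun j => ?_
  simp only [Finset.mem_filter_univ, Finset.forall_mem_union, Finset.forall_mem_map,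
    Fin.castAddEmb_apply, Fin.natAddEmb_apply, oneProd_castAdd, oneProd_natAdd,
    Finset.mem_product, finProdFinEquiv_symm_apply, Function.comp_apply]

theorem rowIndep_oneProd : RowIndep (oneProd S₁ S₂) univ (univ.map (Fin.castAddEmb m₂))
    (univ.map (Fin.natAddEmb m₁)) := by
  intro z
  have h₁ := colCount_oneProd S₁ S₂ univ ∅ z
  have h₂ := colCount_oneProd S₁ S₂ ∅ univ z
  rw [Finset.map_empty, Finset.union_empty, colCount_empty] at h₁
  rw [Finset.map_empty, Finset.empty_union, colCount_empty] at h₂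
  rw [colCount_oneProd, h₁, h₂]
  simp only [Finset.card_univ, Fintype.card_fin]
  ring

end

theorem univ_map_castAddEmb_union_natAddEmb :
    univ.map (Fin.castAddEmb m₂) ∪ univ.map (Fin.natAddEmb m₁) = univ := by
  ext i
  induction i using Fin.addCases <;> simp

theorem IsOneProduct.pos {S : Matrix (Fin m) (Fin n) ℝ} (hS : IsOneProduct S) : 0 < m ∧ 0 < n := by
  obtain ⟨m₁, n₁, m₂, n₂, S₁, S₂, hm₁, hn₁, hm₂, hn₂, e, f, -⟩ := hS
  have hm : m = m₁ + m₂ := by simpa using Fintype.card_congr e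
  have hn : n = n₁ * n₂ := by simpa using Fintype.card_congr f
  exact ⟨by omega, hn ▸ Nat.mul_pos hn₁ hn₂⟩

theorem univ_map_valEmbedding (k : ℕ) : univ.map (Fin.valEmbedding (n := k)) = range k := by
  rw [Fin.map_valEmbedding_univ, Nat.Iio_eq_range]

theorem univ_map_equiv_trans_valEmbedding {k : ℕ} (g : Fin k ≃ Fin m) :
    univ.map (g.toEmbedding.trans Fin.valEmbedding) = range m := by
  rw [← Finset.map_map, Finset.map_univ_equiv, univ_map_valEmbedding]

theorem range_sdiff_map_castAddEmb (g : Fin (m₁ + m₂) ≃ Fin m) :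
    range m \ (univ.map (Fin.castAddEmb m₂)).map (g.toEmbedding.trans Fin.valEmbedding) =
      (univ.map (Fin.natAddEmb m₁)).map (g.toEmbedding.trans Fin.valEmbedding) := by
  rw [← univ_map_equiv_trans_valEmbedding g, ← univ_map_castAddEmb_union_natAddEmb,
    Finset.map_union, Finset.union_sdiff_cancel_left]
  refine (Finset.disjoint_map _).2 <| Finset.disjoint_left.2 fun i => ?_
  induction i using Fin.addCases <;> simp [Fin.ext_iff] <;> omega

theorem map_castAddEmb_eq {g : Fin (m₁ + m₂) ≃ Fin m} {A : Finset ℕ} (hA : A ⊆ range m)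
    (h₁ : ∀ k, (g (Fin.castAdd m₂ k) : ℕ) ∈ A) (h₂ : ∀ k, (g (Fin.natAdd m₁ k) : ℕ) ∉ A) :
    (univ.map (Fin.castAddEmb m₂)).map (g.toEmbedding.trans Fin.valEmbedding) = A := by
  ext a
  simp only [Finset.map_map, Finset.mem_map, Finset.mem_univ, true_and]
  refine ⟨?_, fun ha => ?_⟩
  · rintro ⟨k, rfl⟩
    exact h₁ k
  · obtain ⟨x, rfl⟩ : ∃ x, (g x : ℕ) = a := ⟨g.symm ⟨a, Finset.mem_range.1 (hA ha)⟩, by simp⟩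
    induction x using Fin.addCases with
    | left k => exact ⟨k, rfl⟩
    | right k => exact absurd ha (h₂ k)

theorem IsOneProduct.exists_splitsOff {S : Matrix (Fin m) (Fin n) ℝ} (hS : IsOneProduct S)
    {M : Matrix ℕ ℕ ℝ} (hM : ∀ (i : Fin m) (j : Fin n), M i j = S i j) :
    ∃ Z ≠ range m, 0 ∈ Z ∧ SplitsOff M (range n) (range m) Z := by
  have h0 : 0 ∈ range m := Finset.mem_range.2 hS.pos.1
  obtain ⟨m₁, n₁, m₂, n₂, S₁, S₂, hm₁, -, hm₂, -, e, f, hef⟩ := hS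
  have hind := (rowIndep_oneProd S₁ S₂).map (M' := M)
    (e := e.symm.toEmbedding.trans Fin.valEmbedding)
    (f := f.symm.toEmbedding.trans Fin.valEmbedding) fun i x => by simp [hM, hef]
  have hne : (range m \ (univ.map (Fin.castAddEmb m₂)).map
      (e.symm.toEmbedding.trans Fin.valEmbedding)).Nonempty := by
    rw [range_sdiff_map_castAddEmb]
    simp [Fin.pos_iff_nonempty.1 hm₂]
  rw [univ_map_equiv_trans_valEmbedding, ← range_sdiff_map_castAddEmb] at hind
  set Z := (univ.map (Fin.castAddEmb m₂)).map (e.symm.toEmbedding.trans Fin.valEmbedding)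
  have hZ : Z ⊆ range m := by
    rw [← univ_map_equiv_trans_valEmbedding e.symm]
    exact Finset.map_subset_map.2 (Finset.subset_univ _)
  by_cases h0Z : 0 ∈ Z
  · refine ⟨Z, fun h => ?_, h0Z, hZ, hind⟩
    rw [h, Finset.sdiff_self] at hne
    exact Finset.not_nonempty_empty hne
  · refine ⟨range m \ Z, fun h => ?_, Finset.mem_sdiff.2 ⟨h0, h0Z⟩, Finset.sdiff_subset,
      (Finset.sdiff_sdiff_eq_self hZ).symm ▸ hind.symm⟩
    have hZ₀ : Z.Nonempty := by simp [Z, Fin.pos_iff_nonempty.1 hm₁]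
    exact hZ₀.ne_empty (by rw [← Finset.sdiff_sdiff_eq_self hZ, h, Finset.sdiff_self])

theorem exists_count_eq {p : ℕ → Prop} [DecidablePred p] {k : ℕ} (h : k < m.count p) :
    ∃ i : Fin m, p i ∧ (i : ℕ).count p = k := by
  induction m with
  | zero => simp at h
  | succ m ih =>
    obtain hk | hk := lt_or_ge k (m.count p)
    · obtain ⟨i, hi⟩ := ih hk
      exact ⟨i.castSucc, hi⟩
    · rw [Nat.count_succ] at h
      split_ifs at h with hm
      · exact ⟨Fin.last m, hm, by simp; omega⟩
      · omega

theorem exists_rowEquiv (p : ℕ → Prop) [DecidablePred p] (m : ℕ) :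
    ∃ e : Fin (m.count p + m.count (¬ p ·)) ≃ Fin m,
      (∀ k, p (e (Fin.castAdd _ k)) ∧ (e (Fin.castAdd _ k) : ℕ).count p = k) ∧
      ∀ k, ¬ p (e (Fin.natAdd _ k)) ∧ (e (Fin.natAdd _ k) : ℕ).count (¬ p ·) = k := by
  choose f hf using fun k : Fin (m.count p) => exists_count_eq k.2
  choose g hg using fun k : Fin (m.count (¬ p ·)) => exists_count_eq k.2
  have hsurj : Function.Surjective (Fin.addCases f g : _ → Fin m) := fun i => by
    by_cases hi : p i
    · refine ⟨Fin.castAdd _ ⟨(i : ℕ).count p, Nat.count_strict_mono hi i.2⟩, ?_⟩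
      simp only [Fin.addCases_left]
      exact Fin.ext (Nat.count_injective (hf _).1 hi (hf _).2)
    · refine ⟨Fin.natAdd _ ⟨(i : ℕ).count (¬ p ·), Nat.count_strict_mono (p := (¬ p ·)) hi i.2⟩, ?_⟩
      simp only [Fin.addCases_right]
      exact Fin.ext (Nat.count_injective (p := (¬ p ·)) (hg _).1 hi (hg _).2)
  have hcard : m.count p + m.count (¬ p ·) = m := by
    simpa [Nat.count_eq_card_filter_range] using
      Finset.card_filter_add_card_filter_not (s := range m) p
  refine ⟨Equiv.ofBijective _ ((Fintype.bijective_iff_surjective_and_card _).2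
    ⟨hsurj, by simp [hcard]⟩), fun k => ?_, fun k => ?_⟩
  · simpa using hf k
  · simpa using hg k

theorem matIso_of_colCount {m' n' : ℕ} {S : Matrix (Fin m) (Fin n) ℝ}
    {P : Matrix (Fin m') (Fin n') ℝ} (e : Fin m' ≃ Fin m)
    (h : ∀ z, colCount S univ univ z = colCount P univ univ (z ∘ e)) : MatIso S P := by
  have hfiber (z : Fin m → ℝ) :
      Nonempty ({x // (S · x) = z} ≃ {y // (fun i => P (e.symm i) y) = z}) := by
    refine Fintype.card_eq.1 ?_
    rw [Fintype.card_subtype, Fintype.card_subtype]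
    convert h z using 3
    · simp [colCount, funext_iff]
    · simp [colCount, funext_iff, e.symm.forall_congr_left]
  exact ⟨e.symm, Equiv.ofFiberEquiv fun z => (hfiber z).some, fun i j =>
    (congrFun (Equiv.ofFiberEquiv_map (fun z => (hfiber z).some) j) i).symm⟩

theorem matIso_oneProd_of_isThinning {S : Matrix (Fin m) (Fin n) ℝ} {M F₁ F₂ : Matrix ℕ ℕ ℝ}
    {A : Finset ℕ} {d k w₁ w₂ : ℕ} (hM : ∀ (i : Fin m) (j : Fin n), M i j = S i j)
    (hA : SplitsOff M (range n) (range m) A) (hn : 0 < n) (hdk : d * k = n)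
    (h₁ : IsThinning (F₁.submatrix (Nat.count (· ∈ A)) id) (range w₁) M (range n) A d)
    (h₂ : IsThinning (F₂.submatrix (Nat.count (· ∉ A)) id) (range w₂) M (range n) (range m \ A) k) :
    MatIso S (oneProd
      (F₁.submatrix ((↑) : Fin (m.count (· ∈ A)) → ℕ) ((↑) : Fin w₁ → ℕ))
      (F₂.submatrix ((↑) : Fin (m.count (· ∉ A)) → ℕ) ((↑) : Fin w₂ → ℕ))) := by
  obtain ⟨e, he₁, he₂⟩ := exists_rowEquiv (· ∈ A) m
  refine matIso_of_colCount e fun z => ?_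
  obtain ⟨w, rfl⟩ := (Fin.val_injective (n := m)).surjective_comp_right z
  have hA₁ : (univ.map (Fin.castAddEmb _)).map (e.toEmbedding.trans Fin.valEmbedding) = A :=
    map_castAddEmb_eq hA.1 (fun k => (he₁ k).1) fun k => (he₂ k).1
  have hA₂ : (univ.map (Fin.natAddEmb _)).map (e.toEmbedding.trans Fin.valEmbedding) =
      range m \ A := by
    rw [← range_sdiff_map_castAddEmb, hA₁]
  have hS := colCount_map (s := univ) (A := univ) (e := Fin.valEmbedding) (f := Fin.valEmbedding)
    hM w
  have hP₁ := colCount_map (s := univ) (A := univ) (f := Fin.valEmbedding)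
    (e := (Fin.castAddEmb _).trans (e.toEmbedding.trans Fin.valEmbedding))
    (M := F₁.submatrix ((↑) : Fin (m.count (· ∈ A)) → ℕ) ((↑) : Fin w₁ → ℕ))
    (M' := F₁.submatrix (Nat.count (· ∈ A)) id) (fun i j => by simp [he₁]) w
  have hP₂ := colCount_map (s := univ) (A := univ) (f := Fin.valEmbedding)
    (e := (Fin.natAddEmb _).trans (e.toEmbedding.trans Fin.valEmbedding))
    (M := F₂.submatrix ((↑) : Fin (m.count (· ∉ A)) → ℕ) ((↑) : Fin w₂ → ℕ))
    (M' := F₂.submatrix (Nat.count (· ∉ A)) id) (fun i j => by simp [he₂]) w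
  rw [univ_map_valEmbedding, ← Finset.map_map, hA₁] at hP₁
  rw [univ_map_valEmbedding, ← Finset.map_map, hA₂] at hP₂
  rw [univ_map_valEmbedding, univ_map_valEmbedding] at hS
  rw [← univ_map_castAddEmb_union_natAddEmb, colCount_oneProd]
  calc
    colCount S univ univ (w ∘ Fin.val) = colCount M (range n) (A ∪ range m \ A) w := by
      rw [Finset.union_sdiff_of_subset hA.1, hS]; rfl
    _ = _ := hA.2.colCount_union h₁ h₂ (by rw [hdk, Finset.card_range])
      (Finset.nonempty_range_iff.2 hn.ne')
    _ = _ := by rw [hP₁, hP₂]; rfl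

end OneProduct

section Selection

variable {ι α : Type*} {M N : Matrix ι ℕ α} {A : Finset ι} {d n : ℕ}

/-- The part of a column of `M` in the rows `A`, as a colour for the index of the column. -/
def colPart (M : Matrix ι ℕ α) (A : Finset ι) (x : ℕ) : A → α := A.restrict (M · x)

theorem colPart_eq_restrict_iff {x : ℕ} {z : ι → α} :
    colPart M A x = A.restrict z ↔ ∀ i ∈ A, M i x = z i := by
  simp [colPart, funext_iff]

theorem colPart_eq_iff {x y : ℕ} : colPart M A x = colPart M A y ↔ ∀ i ∈ A, M i x = M i y :=
  colPart_eq_restrict_iff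

variable [DecidableEq α]

theorem colCount_range {z : ι → α} :
    colCount M (Finset.range n) A z = n.count fun x => ∀ i ∈ A, M i x = z i :=
  (Nat.count_eq_card_filter_range _ _).symm

theorem colCount_range_eq_count_colPart {z : ι → α} :
    colCount M (Finset.range n) A z = n.count fun x => colPart M A x = A.restrict z := by
  rw [colCount_range]
  exact count_congr_of_lt fun x _ => colPart_eq_restrict_iff.symm

theorem count_selected_colPart_mul_eq_iff (hd : 0 < d) :
    n.count (Selected (colPart M A) d) * d = n ↔
      ∀ z, d ∣ colCount M (Finset.range n) A z := by
  classical
  simp only [count_selected_mul_eq_iff hd, colCount_range_eq_count_colPart]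
  refine ⟨fun h z => h _, fun h u => ?_⟩
  convert h fun i => if hi : i ∈ A then u ⟨i, hi⟩ else M i 0
  ext i
  simp

theorem isThinning_of_selected (hd : 0 < d) (h : n.count (Selected (colPart M A) d) * d = n)
    (hN : ∀ x < n, Selected (colPart M A) d x →
      ∀ i ∈ A, N i (x.count (Selected (colPart M A) d)) = M i x) :
    IsThinning N (Finset.range (n.count (Selected (colPart M A) d))) M (Finset.range n) A d := by
  intro z
  rw [colCount_range_eq_count_colPart (M := M), ← count_fiber_selected_mul hd h, colCount_range,
    count_count]
  congr 1
  refine count_congr_of_lt fun x hx => ?_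
  rw [and_comm, colPart_eq_restrict_iff]
  refine and_congr_left fun hsel => forall₂_congr fun i hi => ?_
  rw [hN x hx hsel i hi]

end Selection

/-! ### Programs in which all loops count -/

namespace RealRAM

/-- A part of the memory: a variable or a whole array. Sets of parts describe what a piece of code
may write. -/
inductive Component where
  | var (x : ℕ)
  | arr (a : ℕ)
  | rvar (x : ℕ)
  | rarr (a : ℕ)
  deriving DecidableEq

/-- The type of the contents of a part of the memory. -/
abbrev Component.Value : Component → Type
  | .var _ => ℕ
  | .arr _ => ℕ → ℕ → ℕ
  | .rvar _ => ℝ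
  | .rarr _ => ℕ → ℕ → ℝ

namespace State

/-- The contents of a part of the memory. -/
def read (s : State) : (l : Component) → l.Value
  | .var x => s.var x
  | .arr a => s.arr a
  | .rvar x => s.rvar x
  | .rarr a => s.rarr a

/-- The memories `s` and `s'` differ at most in the components `W`. -/
def AgreeOff (W : List Component) (s s' : State) : Prop := ∀ l ∉ W, s'.read l = s.read l

namespace AgreeOff

variable {W W' : List Component} {s s' s'' : State}

protected theorem rfl : AgreeOff W s s := fun _ _ => by rfl

theorem mono (h : AgreeOff W s s') (hW : W ⊆ W') : AgreeOff W' s s' :=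
  fun l hl => h l fun hl' => hl (hW hl')

theorem trans (h : AgreeOff W s s') (h' : AgreeOff W s' s'') : AgreeOff W s s'' :=
  fun l hl => (h' l hl).trans (h l hl)

theorem var (h : AgreeOff W s s') {x : ℕ} (hx : .var x ∉ W) : s'.var x = s.var x := h _ hx

theorem arr (h : AgreeOff W s s') {a : ℕ} (ha : .arr a ∉ W) : s'.arr a = s.arr a := h _ ha

theorem rvar (h : AgreeOff W s s') {x : ℕ} (hx : .rvar x ∉ W) : s'.rvar x = s.rvar x := h _ hx

theorem rarr (h : AgreeOff W s s') {a : ℕ} (ha : .rarr a ∉ W) : s'.rarr a = s.rarr a := h _ ha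

end AgreeOff

variable (s : State) (x y v a b i j k l : ℕ) (r : ℝ)

@[simp] theorem setVar_var : (s.setVar x v).var y = if y = x then v else s.var y := rfl

@[simp] theorem setVar_rvar : (s.setVar x v).rvar = s.rvar := rfl

@[simp] theorem setVar_rarr : (s.setVar x v).rarr = s.rarr := rfl

@[simp] theorem setArr_arr : (s.setArr a i j v).arr b k l =
    if b = a ∧ k = i ∧ l = j then v else s.arr b k l := rfl

@[simp] theorem setRVar_var : (s.setRVar x r).var = s.var := rfl

@[simp] theorem setRVar_rvar : (s.setRVar x r).rvar y = if y = x then r else s.rvar y := rfl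

@[simp] theorem setRArr_var : (s.setRArr a i j r).var = s.var := rfl

@[simp] theorem setRArr_rarr : (s.setRArr a i j r).rarr b k l =
    if b = a ∧ k = i ∧ l = j then r else s.rarr b k l := rfl

theorem agreeOff_setVar : AgreeOff [.var x] s (s.setVar x v) := by
  rintro (y | _ | _ | _) hy <;> first | rfl | exact if_neg fun h => hy (by simp [h])

theorem agreeOff_setArr : AgreeOff [.arr a] s (s.setArr a i j v) := by
  rintro (_ | b | _ | _) hb <;> first
    | rfl
    | exact funext₂ fun _ _ => if_neg fun h => hb (by simp [h.1])

theorem agreeOff_setRVar : AgreeOff [.rvar x] s (s.setRVar x r) := by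
  rintro (_ | _ | y | _) hy <;> first | rfl | exact if_neg fun h => hy (by simp [h])

theorem agreeOff_setRArr : AgreeOff [.rarr a] s (s.setRArr a i j r) := by
  rintro (_ | _ | _ | b) hb <;> first
    | rfl
    | exact funext₂ fun _ _ => if_neg fun h => hb (by simp [h.1])

/-- The contents of the variables `0` and `1`, which bound the number of rounds of loops. -/
def dims : Fin 2 → ℕ := fun b => s.var b

end State

/-- Programs in which the only iteration is counting: `loop c b p` runs `p` for
`c = 0, 1, …, n - 1`, where `n` is the content of the variable `b`. -/
inductive Code where
  | skip
  | set (x : ℕ) (e : NExp)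
  | put (a : ℕ) (i j e : NExp)
  | rset (x : ℕ) (e : RExp)
  | rput (a : ℕ) (i j : NExp) (e : RExp)
  | seq (p q : Code)
  | ite (b : Test) (p q : Code)
  | loop (c : ℕ) (b : Fin 2) (p : Code)

namespace Code

/-- The program of a code. -/
def compile : Code → Program
  | .skip => .skip
  | .set x e => .set x e
  | .put a i j e => .put a i j e
  | .rset x e => .rset x e
  | .rput a i j e => .rput a i j e
  | .seq p q => .seq p.compile q.compile
  | .ite b p q => .ite b p.compile q.compile
  | .loop c b p =>
      .seq (.set c (.const 0))
        (.while (.nle (.add (.var c) (.const 1)) (.var b))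
          (.seq p.compile (.set c (.add (.var c) (.const 1)))))

/-- The memory after `k` rounds of a counting loop with counter `c` and body `f`. -/
def iter (f : State → State) (c : ℕ) (s : State) : ℕ → State
  | 0 => s.setVar c 0
  | k + 1 => (f (iter f c s k)).setVar c (k + 1)

open Classical in
/-- The effect of a code on the memory. -/
noncomputable def run : Code → State → State
  | .skip, s => s
  | .set x e, s => s.setVar x (e.eval s)
  | .put a i j e, s => s.setArr a (i.eval s) (j.eval s) (e.eval s)
  | .rset x e, s => s.setRVar x (e.eval s)
  | .rput a i j e, s => s.setRArr a (i.eval s) (j.eval s) (e.eval s)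
  | .seq p q, s => q.run (p.run s)
  | .ite b p q, s => if b.Holds s then p.run s else q.run s
  | .loop c b p, s => iter p.run c s (s.var b)

/-- What a code may write. -/
def writes : Code → List Component
  | .skip => []
  | .set x _ => [.var x]
  | .put a _ _ _ => [.arr a]
  | .rset x _ => [.rvar x]
  | .rput a _ _ _ => [.rarr a]
  | .seq p q => p.writes ++ q.writes
  | .ite _ p q => p.writes ++ q.writes
  | .loop c _ p => .var c :: p.writes

/-- No loop body changes its loop counter. -/
def isWellFormed : Code → Bool
  | .seq p q => p.isWellFormed && q.isWellFormed
  | .ite _ p q => p.isWellFormed && q.isWellFormed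
  | .loop c _ p => decide (.var c ∉ p.writes) && p.isWellFormed
  | _ => true

/-- A bound for the running time as a polynomial in the variables `0` and `1`. -/
noncomputable def time : Code → MvPolynomial (Fin 2) ℕ
  | .skip => 1
  | .set _ e => (e.cost + 1 : ℕ)
  | .put _ i j e => (i.cost + j.cost + e.cost + 1 : ℕ)
  | .rset _ e => (e.cost + 1 : ℕ)
  | .rput _ i j e => (i.cost + j.cost + e.cost + 1 : ℕ)
  | .seq p q => p.time + q.time
  | .ite b p q => (b.cost : ℕ) + p.time + q.time
  | .loop _ b p => 7 + MvPolynomial.X b * (9 + p.time)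

attribute [simp] NExp.eval RExp.eval Test.Holds

section

variable (s : State) (x a : ℕ) (e f g : NExp) (h : RExp) (p q : Code) (t : Test)

@[simp] theorem run_skip : skip.run s = s := rfl

@[simp] theorem run_set : (set x e).run s = s.setVar x (e.eval s) := rfl

@[simp] theorem run_put :
    (put a e f g).run s = s.setArr a (e.eval s) (f.eval s) (g.eval s) := rfl

@[simp] theorem run_rset : (rset x h).run s = s.setRVar x (h.eval s) := rfl

@[simp] theorem run_rput :
    (rput a e f h).run s = s.setRArr a (e.eval s) (f.eval s) (h.eval s) := rfl

@[simp] theorem run_seq : (seq p q).run s = q.run (p.run s) := rfl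

open Classical in
@[simp] theorem run_ite : (ite t p q).run s = if t.Holds s then p.run s else q.run s := by
  simp only [run]

end

variable {c : ℕ} {b : Fin 2} {p : Code} {s : State}

theorem agreeOff_iter (hp : ∀ s : State, s.AgreeOff p.writes (p.run s)) (k : ℕ) :
    s.AgreeOff (loop c b p).writes (iter p.run c s k) := by
  have hc (s : State) (v : ℕ) : s.AgreeOff (loop c b p).writes (s.setVar c v) :=
    (s.agreeOff_setVar c v).mono (by simp [writes])
  induction k with
  | zero => exact hc s 0
  | succ k ih => exact (ih.trans ((hp _).mono (by simp [writes]))).trans (hc _ _)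

theorem agreeOff_run (p : Code) (s : State) : s.AgreeOff p.writes (p.run s) := by
  induction p generalizing s with
  | skip => exact .rfl
  | set x e => exact State.agreeOff_setVar s x _
  | put a i j e => exact State.agreeOff_setArr s _ a _ _
  | rset x e => exact State.agreeOff_setRVar s x _
  | rput a i j e => exact State.agreeOff_setRArr s a _ _ _
  | seq p q hp hq =>
    exact ((hp s).mono (List.subset_append_left _ _)).trans
      ((hq _).mono (List.subset_append_right _ _))
  | ite b p q hp hq =>
    rw [run_ite]
    split_ifs
    · exact (hp s).mono (List.subset_append_left _ _)
    · exact (hq s).mono (List.subset_append_right _ _)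
  | loop c b p hp => exact agreeOff_iter hp _

theorem iter_var_counter (f : State → State) (c : ℕ) (s : State) (k : ℕ) :
    (iter f c s k).var c = k := by
  cases k <;> simp [iter]

theorem loop_induction {n : ℕ} (hn : s.var b = n) (Inv : ℕ → State → Prop)
    (zero : Inv 0 (s.setVar c 0))
    (succ : ∀ k < n, ∀ s', s.AgreeOff (loop c b p).writes s' → s'.var c = k → Inv k s' →
      Inv (k + 1) ((p.run s').setVar c (k + 1))) :
    Inv n ((loop c b p).run s) := by
  have key : ∀ k ≤ n, Inv k (iter p.run c s k) := by
    intro k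
    induction k with
    | zero => exact fun _ => zero
    | succ k ih =>
      exact fun hk => succ k hk _ (agreeOff_iter (agreeOff_run p) k) (iter_var_counter _ _ _ _)
        (ih (Nat.le_of_succ_le hk))
  subst hn
  exact key _ le_rfl

theorem exec_while {T : ℕ} (hb : .var b ∉ (loop c b p).writes) (hc : .var c ∉ p.writes)
    (hp : ∀ k, ∃ t ≤ T, Exec p.compile (iter p.run c s k) t (p.run (iter p.run c s k)))
    {j k : ℕ} (hjk : j + k = s.var b) :
    ∃ t ≤ 5 + j * (9 + T),
      Exec (.while (.nle (.add (.var c) (.const 1)) (.var b))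
          (.seq p.compile (.set c (.add (.var c) (.const 1)))))
        (iter p.run c s k) t (iter p.run c s (s.var b)) := by
  have hbound (k : ℕ) : (iter p.run c s k).var b = s.var b :=
    (agreeOff_iter (b := b) (agreeOff_run p) k).var hb
  induction j generalizing k with
  | zero =>
    obtain rfl : k = s.var b := by omega
    exact ⟨5, by omega, .whileFalse (by simp [iter_var_counter, hbound])⟩
  | succ j ih =>
    obtain ⟨t, ht, hbody⟩ := hp k
    obtain ⟨t', ht', hrest⟩ := ih (k := k + 1) (by omega)
    have hcounter : (p.run (iter p.run c s k)).var c = k := by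
      rw [(agreeOff_run p _).var hc, iter_var_counter]
    refine ⟨5 + (t + 4) + t', ?_, .whileTrue ?_ (.seq hbody (.set _ _ _)) ?_⟩
    · linarith
    · simp only [Test.Holds, NExp.eval, iter_var_counter, hbound]
      omega
    · simpa only [iter, NExp.eval, hcounter] using hrest

theorem exec_loop {T : ℕ} (hb : .var b ∉ (loop c b p).writes) (hc : .var c ∉ p.writes)
    (hp : ∀ k, ∃ t ≤ T, Exec p.compile (iter p.run c s k) t (p.run (iter p.run c s k))) :
    ∃ t ≤ 7 + s.var b * (9 + T), Exec (loop c b p).compile s t ((loop c b p).run s) := by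
  obtain ⟨t, ht, h⟩ := exec_while (j := s.var b) (k := 0) hb hc hp rfl
  exact ⟨2 + t, by omega, .seq (.set s c _) h⟩

theorem exec_compile (p : Code) (hp : p.isWellFormed) (hdims : ∀ b : Fin 2, .var b ∉ p.writes)
    (s : State) : ∃ t ≤ MvPolynomial.eval s.dims p.time, Exec p.compile s t (p.run s) := by
  induction p generalizing s with
  | skip => exact ⟨1, by simp [time], .skip _⟩
  | set x e => exact ⟨_, by simp [time], .set _ _ _⟩
  | put a i j e => exact ⟨_, by simp [time], .put _ _ _ _ _⟩
  | rset x e => exact ⟨_, by simp [time], .rset _ _ _⟩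
  | rput a i j e => exact ⟨_, by simp [time], .rput _ _ _ _ _⟩
  | seq p q ihp ihq =>
    simp only [isWellFormed, Bool.and_eq_true, writes, List.mem_append, not_or] at hp hdims
    obtain ⟨t, ht, h⟩ := ihp hp.1 (fun b => (hdims b).1) s
    obtain ⟨t', ht', h'⟩ := ihq hp.2 (fun b => (hdims b).2) (p.run s)
    have hs : (p.run s).dims = s.dims := funext fun b => (agreeOff_run p s).var (hdims b).1
    exact ⟨t + t', by rw [time, map_add]; exact add_le_add ht (hs ▸ ht'), .seq h h'⟩
  | ite b p q ihp ihq =>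
    simp only [isWellFormed, Bool.and_eq_true, writes, List.mem_append, not_or] at hp hdims
    have htime : MvPolynomial.eval s.dims (ite b p q).time =
        b.cost + MvPolynomial.eval s.dims p.time + MvPolynomial.eval s.dims q.time := by
      simp [time]
    by_cases hb : b.Holds s
    · obtain ⟨t, ht, h⟩ := ihp hp.1 (fun b => (hdims b).1) s
      exact ⟨b.cost + t, by omega, by rw [run_ite, if_pos hb]; exact .iteTrue hb h⟩
    · obtain ⟨t, ht, h⟩ := ihq hp.2 (fun b => (hdims b).2) s
      exact ⟨b.cost + t, by omega, by rw [run_ite, if_neg hb]; exact .iteFalse hb h⟩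
  | loop c b p ih =>
    simp only [isWellFormed, Bool.and_eq_true, decide_eq_true_eq] at hp
    have hbody (k : ℕ) : ∃ t ≤ MvPolynomial.eval s.dims p.time,
        Exec p.compile (iter p.run c s k) t (p.run (iter p.run c s k)) := by
      have hs : (iter p.run c s k).dims = s.dims := funext fun b' =>
        (agreeOff_iter (b := b) (agreeOff_run p) k).var (hdims b')
      exact hs ▸ ih hp.2 (fun b hb => hdims b (List.mem_cons_of_mem _ hb)) (iter p.run c s k)
    obtain ⟨t, ht, h⟩ := exec_loop (hdims b) hp.1 hbody
    exact ⟨t, by simpa [time, State.dims] using ht, h⟩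

end Code

/-! ### Growing a set of rows that splits off -/

namespace Reg

@[simp] abbrev rows : ℕ := 0
@[simp] abbrev cols : ℕ := 1
@[simp] abbrev bound : ℕ := 2
@[simp] abbrev round : ℕ := 3
@[simp] abbrev position : ℕ := 4
@[simp] abbrev col : ℕ := 5
@[simp] abbrev col₁ : ℕ := 6
@[simp] abbrev col₂ : ℕ := 7
@[simp] abbrev row : ℕ := 8
@[simp] abbrev same₁ : ℕ := 9
@[simp] abbrev same₂ : ℕ := 10
@[simp] abbrev dependent : ℕ := 11
@[simp] abbrev trial : ℕ := 12
@[simp] abbrev step : ℕ := 13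
@[simp] abbrev rem : ℕ := 14
@[simp] abbrev total : ℕ := 15
@[simp] abbrev height : ℕ := 16
@[simp] abbrev height₁ : ℕ := 17
@[simp] abbrev height₂ : ℕ := 18
@[simp] abbrev width₁ : ℕ := 19
@[simp] abbrev width₂ : ℕ := 20
@[simp] abbrev found : ℕ := 21

end Reg

namespace RReg

@[simp] abbrev all : ℕ := 0
@[simp] abbrev count₁ : ℕ := 1
@[simp] abbrev count₂ : ℕ := 2
@[simp] abbrev both : ℕ := 3

end RReg

open Code Reg Finset

variable {M : Matrix ℕ ℕ ℝ} {m n : ℕ} {A : Finset ℕ} {s s' : State}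

/-- The memory holds the matrix `M`, of which the first `m` rows and `n` columns matter, and a
set `A` of marked rows. -/
structure State.Stores (s : State) (M : Matrix ℕ ℕ ℝ) (m n : ℕ) (A : Finset ℕ) : Prop where
  var_rows : s.var rows = m
  var_cols : s.var cols = n
  rarr_eq : ∀ i j, s.rarr 0 i j = M i j
  mem_iff : ∀ i, s.arr 0 i 0 = 1 ↔ i ∈ A
  subset : A ⊆ range m

namespace State.Stores

theorem of_agreeOff {W : List Component} (h : s.Stores M m n A) (hF : s.AgreeOff W s')
    (hW : ∀ l ∈ [Component.var rows, .var cols, .arr 0, .rarr 0], l ∉ W) :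
    s'.Stores M m n A where
  var_rows := (hF.var (hW _ (by decide))).trans h.var_rows
  var_cols := (hF.var (hW _ (by decide))).trans h.var_cols
  rarr_eq i j := by rw [hF.rarr (hW _ (by decide)), h.rarr_eq]
  mem_iff i := by rw [hF.arr (hW _ (by decide)), h.mem_iff]
  subset := h.subset

theorem setVar (h : s.Stores M m n A) {x : ℕ} (hx : cols < x) (v : ℕ) :
    (s.setVar x v).Stores M m n A :=
  h.of_agreeOff (s.agreeOff_setVar x v) (by simp at *; omega)

theorem loop_rows {c : ℕ} {p : Code} (h : s.Stores M m n A) (Inv : ℕ → State → Prop)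
    (hW : ∀ l ∈ [Component.var rows, .var cols, .arr 0, .rarr 0], l ∉ (loop c 0 p).writes)
    (zero : Inv 0 (s.setVar c 0))
    (succ : ∀ k < m, ∀ s', s.AgreeOff (loop c 0 p).writes s' → s'.Stores M m n A →
      s'.var c = k → Inv k s' → Inv (k + 1) ((p.run s').setVar c (k + 1))) :
    Inv m ((loop c 0 p).run s) :=
  loop_induction h.var_rows Inv zero fun k hk s' hF => succ k hk s' hF (h.of_agreeOff hF hW)

theorem loop_cols {c : ℕ} {p : Code} (h : s.Stores M m n A) (Inv : ℕ → State → Prop)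
    (hW : ∀ l ∈ [Component.var rows, .var cols, .arr 0, .rarr 0], l ∉ (loop c 1 p).writes)
    (zero : Inv 0 (s.setVar c 0))
    (succ : ∀ k < n, ∀ s', s.AgreeOff (loop c 1 p).writes s' → s'.Stores M m n A →
      s'.var c = k → Inv k s' → Inv (k + 1) ((p.run s').setVar c (k + 1))) :
    Inv n ((loop c 1 p).run s) :=
  loop_induction h.var_cols Inv zero fun k hk s' hF => succ k hk s' hF (h.of_agreeOff hF hW)

end State.Stores

/-- Whether the row in hand is marked. -/
def isMarked : Test := .neq (.get 0 (.var row) (.const 0)) (.const 1)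

/-- The entry in the row in hand and the column in the variable `x`. -/
def entry (x : ℕ) : RExp := .get 0 (.var row) (.var x)

theorem State.Stores.holds_isMarked (h : s.Stores M m n A) :
    isMarked.Holds s ↔ s.var row ∈ A := h.mem_iff _

theorem State.Stores.eval_entry (h : s.Stores M m n A) (x : ℕ) :
    (entry x).eval s = M (s.var row) (s.var x) := h.rarr_eq _ _

/-- Clears `same₁` or `same₂` if the row in hand tells apart the columns to be compared. -/
def compareRow : Code :=
  .ite isMarked
    (.ite (.req (entry col) (entry col₁)) .skip (.set same₁ (.const 0)))
    (.ite (.nle (.var bound) (.var row)) .skip <|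
      .ite (.req (entry col) (entry col₂)) .skip (.set same₂ (.const 0)))

/-- Compares the column `col` with the column `col₁` on the marked rows and with the column `col₂`
on the unmarked rows above `bound`. -/
def compare : Code :=
  .seq (.set same₁ (.const 1)) <| .seq (.set same₂ (.const 1)) <| .loop row 0 compareRow

theorem compare_run (h : s.Stores M m n A) (hb : s.var bound ≤ m) :
    ((compare.run s).var same₁ = 1 ↔ ∀ i ∈ A, M i (s.var col) = M i (s.var col₁)) ∧
    ((compare.run s).var same₂ = 1 ↔
      ∀ i ∈ range (s.var bound) \ A, M i (s.var col) = M i (s.var col₂)) := by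
  have h₀ := (h.setVar (x := same₁) (by decide) 1).setVar (x := same₂) (by decide) 1
  have key := h₀.loop_rows (c := row) (p := compareRow) (fun k s' =>
    (s'.var same₁ = 1 ↔ ∀ i < k, i ∈ A → M i (s.var col) = M i (s.var col₁)) ∧
    (s'.var same₂ = 1 ↔
      ∀ i < k, i ∉ A → i < s.var bound → M i (s.var col) = M i (s.var col₂)))
    (by decide) (by simp) fun k _ s' hF h' hc ih => ?_
  · refine ⟨key.1.trans (forall_congr' fun i => ?_), key.2.trans (forall_congr' fun i => ?_)⟩
    · exact ⟨fun h' hi => h' (mem_range.1 (h.subset hi)) hi, fun h' _ => h'⟩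
    · rw [mem_sdiff, mem_range]
      exact ⟨fun h' hi => h' (hi.1.trans_le hb) hi.2 hi.1, fun h' _ hi hi' => h' ⟨hi', hi⟩⟩
  · have hbound : s'.var bound = s.var bound := hF.var (by decide)
    have hcol : s'.var col = s.var col := hF.var (by decide)
    have hcol₁ : s'.var col₁ = s.var col₁ := hF.var (by decide)
    have hcol₂ : s'.var col₂ = s.var col₂ := hF.var (by decide)
    simp only [Nat.forall_lt_succ_right, ← ih.1, ← ih.2, compareRow, run_ite, Test.Holds,
      h'.holds_isMarked, h'.eval_entry, hc, hcol, hcol₁, hcol₂, NExp.eval, hbound]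
    split_ifs with h₁ h₂ h₃ h₄
    · simp [h₁, h₂]
    · simp [h₁, h₂]
    · simp [h₁, h₃]
    · simp [h₁, h₄]
    · simp [h₁, lt_of_not_ge h₃, h₄]

theorem State.Stores.setRVar (h : s.Stores M m n A) (x : ℕ) (r : ℝ) :
    (s.setRVar x r).Stores M m n A :=
  h.of_agreeOff (s.agreeOff_setRVar x r) (by simp)

/-- Counts the column `col` among the columns that agree with `col₁` on the marked rows, among
those that agree with `col₂` on the unmarked rows above `bound`, and among both. -/
def countCol : Code :=
  .seq compare <| .seq (.rset RReg.all (.add (.var RReg.all) .one)) <|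
  .seq (.ite (.neq (.var same₁) (.const 1))
    (.rset RReg.count₁ (.add (.var RReg.count₁) .one)) .skip) <|
  .seq (.ite (.neq (.var same₂) (.const 1))
    (.rset RReg.count₂ (.add (.var RReg.count₂) .one)) .skip) <|
  .ite (.and (.neq (.var same₁) (.const 1)) (.neq (.var same₂) (.const 1)))
    (.rset RReg.both (.add (.var RReg.both) .one)) .skip

/-- Counts columns, in real variables since the counts are to be multiplied. -/
def countCols : Code :=
  .seq (.rset RReg.all .zero) <| .seq (.rset RReg.count₁ .zero) <|
  .seq (.rset RReg.count₂ .zero) <| .seq (.rset RReg.both .zero) <| .loop col 1 countCol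

theorem countCols_run (h : s.Stores M m n A) (hb : s.var bound ≤ m) :
    (countCols.run s).rvar RReg.all = n ∧
    (countCols.run s).rvar RReg.count₁ =
      n.count (fun x => ∀ i ∈ A, M i x = M i (s.var col₁)) ∧
    (countCols.run s).rvar RReg.count₂ =
      n.count (fun x => ∀ i ∈ range (s.var bound) \ A, M i x = M i (s.var col₂)) ∧
    (countCols.run s).rvar RReg.both =
      n.count (fun x => (∀ i ∈ A, M i x = M i (s.var col₁)) ∧
        ∀ i ∈ range (s.var bound) \ A, M i x = M i (s.var col₂)) := by
  have h₀ := (((h.setRVar RReg.all 0).setRVar RReg.count₁ 0).setRVar RReg.count₂ 0).setRVar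
    RReg.both 0
  refine h₀.loop_cols (c := col) (p := countCol) (fun k s' => s'.rvar RReg.all = k ∧
    s'.rvar RReg.count₁ = k.count (fun x => ∀ i ∈ A, M i x = M i (s.var col₁)) ∧
    s'.rvar RReg.count₂ =
      k.count (fun x => ∀ i ∈ range (s.var bound) \ A, M i x = M i (s.var col₂)) ∧
    s'.rvar RReg.both = k.count (fun x => (∀ i ∈ A, M i x = M i (s.var col₁)) ∧
      ∀ i ∈ range (s.var bound) \ A, M i x = M i (s.var col₂))) (by decide) (by simp)
    fun k _ s' hF h' hc ⟨hall, hcount₁, hcount₂, hboth⟩ => ?_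
  have hbound : s'.var bound = s.var bound := hF.var (by decide)
  have hcol₁ : s'.var col₁ = s.var col₁ := hF.var (by decide)
  have hcol₂ : s'.var col₂ = s.var col₂ := hF.var (by decide)
  obtain ⟨hsame₁, hsame₂⟩ := compare_run h' (hbound.trans_le hb)
  have hreal (x : ℕ) : (compare.run s').rvar x = s'.rvar x :=
    (agreeOff_run compare s').rvar (by simp [compare, compareRow, writes])
  simp only [hc, hbound, hcol₁, hcol₂] at hsame₁ hsame₂
  simp only [Nat.count_succ, ← hsame₁, ← hsame₂]
  by_cases h₁ : (compare.run s').var same₁ = 1 <;> by_cases h₂ : (compare.run s').var same₂ = 1 <;>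
    simp [countCol, h₁, h₂, hreal, hall, hcount₁, hcount₂, hboth]

/-- Sets `dependent` if the columns `col₁` and `col₂` witness that the marked rows are not
independent of the unmarked rows above `bound`. -/
def testPair : Code :=
  .seq countCols <| .ite (.req (.mul (.var RReg.both) (.var RReg.all))
    (.mul (.var RReg.count₁) (.var RReg.count₂))) .skip (.set dependent (.const 1))

/-- Tests whether the marked rows are independent of the unmarked rows above `bound`. -/
def testIndep : Code :=
  .seq (.set dependent (.const 0)) <| .loop col₁ 1 <| .loop col₂ 1 testPair

theorem rowIndep_range_iff {B : Finset ℕ} (hAB : Disjoint A B) :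
    RowIndep M (range n) A B ↔ ∀ a < n, ∀ b < n,
      n.count (fun x => (∀ i ∈ A, M i x = M i a) ∧ ∀ i ∈ B, M i x = M i b) * n =
        n.count (fun x => ∀ i ∈ A, M i x = M i a) * n.count (fun x => ∀ i ∈ B, M i x = M i b) := by
  simp only [rowIndep_iff hAB, colCount, ← Nat.count_eq_card_filter_range, mem_range, card_range]

theorem testIndep_run (h : s.Stores M m n A) (hb : s.var bound ≤ m) :
    (testIndep.run s).var dependent = 0 ↔ RowIndep M (range n) A (range (s.var bound) \ A) := by
  rw [rowIndep_range_iff disjoint_sdiff]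
  set P : ℕ → ℕ → Prop := fun a b => _ = _ with hP
  have h₀ := h.setVar (x := dependent) (by decide) 0
  refine h₀.loop_cols (c := col₁) (p := .loop col₂ 1 testPair)
    (fun k s' => s'.var dependent = 0 ↔ ∀ a < k, ∀ b < n, P a b) (by decide) (by simp)
    fun k _ s' hF h' hc ih => ?_
  have key := h'.loop_cols (c := col₂) (p := testPair)
    (fun l s'' => s''.var dependent = 0 ↔ (∀ a < k, ∀ b < n, P a b) ∧ ∀ b < l, P k b) (by decide)
    (by simpa using ih) fun l _ s'' hF' h'' hc' ih' => ?_
  · rw [Nat.forall_lt_succ_right]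
    exact key
  have hbound : s''.var bound = s.var bound :=
    (hF'.var (by decide)).trans (hF.var (x := bound) (by decide))
  have hcol₁ : s''.var col₁ = k := (hF'.var (by decide)).trans hc
  have hdep : (countCols.run s'').var dependent = s''.var dependent :=
    (agreeOff_run countCols s'').var (by decide)
  obtain ⟨hall, hcount₁, hcount₂, hboth⟩ := countCols_run h'' (hbound.trans_le hb)
  simp only [hbound, hcol₁, hc'] at hcount₁ hcount₂ hboth
  have hiff : (Test.req (.mul (.var RReg.both) (.var RReg.all))
      (.mul (.var RReg.count₁) (.var RReg.count₂))).Holds (countCols.run s'') ↔ P k l := by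
    simp only [Test.Holds, RExp.eval, hall, hcount₁, hcount₂, hboth, hP]
    exact_mod_cast Iff.rfl
  rw [Nat.forall_lt_succ_right, ← and_assoc, ← ih', testPair, run_seq, run_ite]
  by_cases hkl : P k l
  · rw [if_pos (hiff.2 hkl)]
    simp [hdep, hkl]
  · rw [if_neg (hiff.not.2 hkl)]
    simp [hkl]

theorem State.Stores.mark (h : s.Stores M m n A) {r : ℕ} (hr : r < m) :
    (s.setArr 0 r 0 1).Stores M m n (insert r A) where
  var_rows := h.var_rows
  var_cols := h.var_cols
  rarr_eq := h.rarr_eq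
  mem_iff i := by
    rw [mem_insert, ← h.mem_iff]
    by_cases hi : i = r <;> simp [hi]
  subset := insert_subset (mem_range.2 hr) h.subset

/-- Moves `bound` down by one row if this keeps the unmarked rows above it independent of the
marked ones. -/
def scanStep : Code :=
  .seq testIndep <| .ite (.neq (.var dependent) (.const 0))
    (.set bound (.add (.var bound) (.const 1))) .skip

/-- Moves `bound` just below the first row on which the marked rows depend, in conjunction with
the rows above it. -/
def scan : Code := .seq (.set bound (.const 1)) <| .loop position 0 scanStep

theorem scan_run (h : s.Stores M m n A) : ∃ b ≤ m, (scan.run s).var bound = b + 1 ∧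
    RowIndep M (range n) A (range b \ A) ∧
    (b = m ∨ ¬ RowIndep M (range n) A (range (b + 1) \ A)) := by
  have h₀ := h.setVar (x := bound) (by decide) 1
  refine h₀.loop_rows (c := position) (p := scanStep) (fun k s' => ∃ b ≤ k,
    s'.var bound = b + 1 ∧ RowIndep M (range n) A (range b \ A) ∧
    (b = k ∨ ¬ RowIndep M (range n) A (range (b + 1) \ A))) (by decide)
    ⟨0, by simp [RowIndep.empty_right]⟩ fun k _ s' _ h' _ ⟨b, hbk, hb, hind, hdep⟩ => ?_
  have htest := testIndep_run h' (by omega)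
  have hbound : (testIndep.run s').var bound = b + 1 :=
    ((agreeOff_run testIndep s').var (by decide)).trans hb
  rw [hb] at htest
  by_cases hi : RowIndep M (range n) A (range (b + 1) \ A)
  · obtain rfl : b = k := hdep.resolve_right (not_not.2 hi)
    exact ⟨b + 1, le_rfl, by simp [scanStep, htest.2 hi, hbound], hi, .inl rfl⟩
  · exact ⟨b, by omega, by simp [scanStep, htest.not.2 hi, hbound], hind, .inr hi⟩

/-- Marks the first row on which the marked rows depend, if there is one. -/
def growStep : Code :=
  .seq scan <| .ite (.nle (.var bound) (.var rows))
    (.put 0 (.sub (.var bound) (.const 1)) (.const 0) (.const 1)) .skip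

theorem growStep_run (h : s.Stores M m n A) :
    (growStep.run s).Stores M m n A ∧ RowIndep M (range n) A (range m \ A) ∨
    ∃ r ∉ A, (growStep.run s).Stores M m n (insert r A) ∧
      ¬ RowIndep M (range n) A (range m \ A) ∧
      ∀ Z, A ⊆ Z → SplitsOff M (range n) (range m) Z → r ∈ Z := by
  obtain ⟨b, hbm, hb, hind, hdep⟩ := scan_run h
  have h' : (scan.run s).Stores M m n A := h.of_agreeOff (agreeOff_run scan s) (by decide)
  obtain hlt | rfl := hbm.lt_or_eq
  · have hdep := hdep.resolve_left hlt.ne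
    have hbA : b ∉ A := fun hbA => hdep (by rwa [range_add_one, insert_sdiff_of_mem _ hbA])
    refine .inr ⟨b, hbA, ?_, fun hi => hdep ?_, fun Z hAZ hZ => ?_⟩
    · have hrows := h'.var_rows
      have hle : b + 1 ≤ m := hlt
      simpa [growStep, hb, hrows, hle] using h'.mark hlt
    · exact hi.mono_right disjoint_sdiff (sdiff_subset_sdiff (range_subset_range.2 hlt) subset_rfl)
    · refine hZ.mem_of_not_insert hAZ (sdiff_subset.trans (range_subset_range.2 hbm))
        (mem_range.2 hlt) disjoint_sdiff hind ?_
      rwa [← insert_sdiff_of_notMem _ hbA, ← range_add_one]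
  · refine .inl ⟨?_, hind⟩
    have hrows := h'.var_rows
    simpa [growStep, hb, hrows] using h'

/-- Marks the rows of the least set that contains the row `0` and splits off. -/
def grow : Code :=
  .seq (.put 0 (.const 0) (.const 0) (.const 1)) <| .loop round 0 growStep

theorem grow_run (h : s.Stores M m n ∅) (hm : 0 < m) : ∃ A, (grow.run s).Stores M m n A ∧
    IsLeast {Z | 0 ∈ Z ∧ SplitsOff M (range n) (range m) Z} A := by
  have h₀ := h.mark hm
  have key := loop_induction (c := round) (b := 0) (p := growStep)
    h₀.var_rows (fun k s' => ∃ A, s'.Stores M m n A ∧ 0 ∈ A ∧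
      (RowIndep M (range n) A (range m \ A) ∨ k + 1 ≤ #A) ∧
      ∀ Z, 0 ∈ Z → SplitsOff M (range n) (range m) Z → A ⊆ Z)
    ⟨{0}, h₀.setVar (by decide) 0, by simp +contextual⟩ ?_
  · obtain ⟨A, hA, h0, hind, hle⟩ := key
    refine ⟨A, hA, ⟨h0, hA.subset, hind.resolve_right fun hcard => ?_⟩, fun Z hZ => hle Z hZ.1 hZ.2⟩
    exact absurd (card_range m ▸ card_le_card hA.subset) (by omega)
  · rintro k - s' - - ⟨A, hA, h0, hind, hle⟩
    obtain ⟨h', hind'⟩ | ⟨r, hr, h', hdep, hrZ⟩ := growStep_run hA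
    · exact ⟨A, h'.setVar (by decide) _, h0, .inl hind', hle⟩
    · refine ⟨insert r A, h'.setVar (by decide) _, mem_insert_of_mem h0, .inr ?_, fun Z h0 hZ => ?_⟩
      · rw [card_insert_of_notMem hr]
        exact Nat.succ_le_succ (hind.resolve_left hdep)
      · exact insert_subset (hrZ Z (hle Z h0 hZ) hZ) (hle Z h0 hZ)

/-! ### Copying factors out of the matrix -/

/-- The two groups of rows, for code that is to be run for either of them. -/
inductive Side where
  | marked
  | unmarked

namespace Side

/-- The variable for the index of a column that is looked at in the rows on this side. -/
def column : Side → ℕ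
  | marked => col₁
  | unmarked => col₂

/-- The variable for the result of the comparison with the column in `column`. -/
def same : Side → ℕ
  | marked => same₁
  | unmarked => same₂

/-- The variable for the number of columns of the factor. -/
def width : Side → ℕ
  | marked => width₁
  | unmarked => width₂

/-- The real array for the factor. -/
def target : Side → ℕ
  | marked => 1
  | unmarked => 2

/-- Whether the row in hand is on this side. -/
def test : Side → Test
  | marked => isMarked
  | unmarked => .not isMarked

/-- Whether a row is on this side, given the set `A` of marked rows. -/
def Mem (A : Finset ℕ) : Side → ℕ → Prop
  | marked, i => i ∈ A
  | unmarked, i => i ∉ A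

instance (A : Finset ℕ) : (side : Side) → DecidablePred (side.Mem A)
  | marked, i => inferInstanceAs (Decidable (i ∈ A))
  | unmarked, i => inferInstanceAs (Decidable (i ∉ A))

/-- The set of the rows on this side, given the number `m` of rows and the set `A` of marked
rows. -/
def rows (m : ℕ) (A : Finset ℕ) : Side → Finset ℕ
  | marked => A
  | unmarked => range m \ A

theorem mem_rows (hA : A ⊆ range m) {i : ℕ} :
    (side : Side) → (i ∈ side.rows m A ↔ i < m ∧ side.Mem A i)
  | marked => by simpa [rows, Mem] using fun hi => mem_range.1 (hA hi)
  | unmarked => by simp [rows, Mem]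

end Side

section

variable (side : Side)

theorem State.Stores.holds_test (h : s.Stores M m n A) :
    side.test.Holds s ↔ side.Mem A (s.var row) := by
  cases side
  · exact h.holds_isMarked
  · exact h.holds_isMarked.not

theorem compare_run_same (h : s.Stores M m n A) (hb : s.var bound = m) :
    (compare.run s).var side.same = 1 ↔
      ∀ i ∈ side.rows m A, M i (s.var col) = M i (s.var side.column) := by
  have key := compare_run h hb.le
  rw [hb] at key
  cases side
  exacts [key.1, key.2]

/-- Counts the column `col`, modulo `step`, if it is a previous column and agrees with the column
in hand. -/
def residueStep : Code :=
  .ite (.nle (.add (.var col) (.const 1)) (.var side.column))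
    (.seq compare <| .ite (.neq (.var side.same) (.const 1))
      (.seq (.set rem (.add (.var rem) (.const 1))) <|
        .ite (.neq (.var rem) (.var step)) (.set rem (.const 0)) .skip) .skip) .skip

/-- Counts, modulo `step`, the previous columns that agree with the column in hand. -/
def residue : Code := .seq (.set rem (.const 0)) <| .loop col 1 (residueStep side)

theorem succ_mod_eq_ite {a d : ℕ} (hd : 0 < d) :
    (a + 1) % d = if a % d + 1 = d then 0 else a % d + 1 := by
  have hlt := Nat.mod_lt a hd
  rw [← Nat.mod_add_mod]
  split_ifs with h
  · rw [h, Nat.mod_self]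
  · exact Nat.mod_eq_of_lt (by omega)

theorem residueStep_run (h : s.Stores M m n A) (hb : s.var bound = m) (hd : 0 < s.var step)
    {p : ℕ → Prop} [DecidablePred p]
    (hp : p (s.var col) ↔ s.var col < s.var side.column ∧
      ∀ i ∈ side.rows m A, M i (s.var col) = M i (s.var side.column))
    (hrem : s.var rem = (s.var col).count p % s.var step) :
    ((residueStep side).run s).var rem = (s.var col + 1).count p % s.var step := by
  rw [← compare_run_same side h hb] at hp
  have hrem' : (compare.run s).var rem = s.var rem := (agreeOff_run compare s).var (by decide)
  have hstep : (compare.run s).var step = s.var step := (agreeOff_run compare s).var (by decide)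
  rw [Nat.count_succ]
  by_cases hcol : s.var col < s.var side.column
  · by_cases hsame : (compare.run s).var side.same = 1
    · have hle : s.var col + 1 ≤ s.var side.column := hcol
      rw [if_pos (hp.2 ⟨hcol, hsame⟩), succ_mod_eq_ite hd, ← hrem]
      by_cases hmod : s.var rem + 1 = s.var step <;>
        simp [residueStep, hle, hsame, hrem', hstep, hmod]
    · simp [residueStep, hp, hcol, hsame, hrem', hrem]
  · simp [residueStep, hp, hcol, hrem]

theorem residue_run (h : s.Stores M m n A) (hb : s.var bound = m) (hd : 0 < s.var step) {x : ℕ}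
    (hcolumn : s.var side.column = x) (hx : x < n) : ((residue side).run s).var rem =
      x.count (fun y => colPart M (side.rows m A) y = colPart M (side.rows m A) x) %
        s.var step := by
  have h₀ := h.setVar (x := rem) (by decide) 0
  have key := h₀.loop_cols (c := col) (p := residueStep side) (fun k s' => s'.var rem =
    k.count (fun y => y < x ∧ ∀ i ∈ side.rows m A, M i y = M i x) % s.var step)
    (by cases side <;> decide) (by simp) fun k _ s' hF h' hc ih => ?_
  · refine key.trans (congrArg (· % _) ?_)
    rw [Nat.count_eq_card_filter_range, Nat.count_eq_card_filter_range]
    refine congrArg card (Finset.ext fun y => ?_)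
    rw [mem_filter, mem_filter, mem_range, mem_range, colPart_eq_iff]
    exact ⟨fun hy => hy.2, fun hy => ⟨hy.1.trans hx, hy⟩⟩
  · have hbound : s'.var bound = s.var bound := hF.var (by cases side <;> decide)
    have hstep : s'.var step = s.var step := hF.var (by cases side <;> decide)
    have hcolumn' : s'.var side.column = x := by
      cases side <;> exact (hF.var (by decide)).trans hcolumn
    have := residueStep_run side h' (hbound.trans hb) (hstep ▸ hd)
      (p := fun y => y < x ∧ ∀ i ∈ side.rows m A, M i y = M i x) (by rw [hcolumn'])
      (by rw [ih, hc, hstep])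
    simpa [hc, hstep] using this

/-- Appends the entry in the row in hand to the new column if the row is on the given side. -/
def copyEntry : Code :=
  .ite side.test (.seq
    (.rput side.target (.var height) (.var side.width) (entry side.column))
    (.set height (.add (.var height) (.const 1)))) .skip

/-- Appends the part of the column in hand on the given side to the columns of the factor. -/
def copyColumn : Code := .seq (.set height (.const 0)) <| .loop row 0 (copyEntry side)

theorem copyColumn_run (h : s.Stores M m n A) {x w : ℕ} (hcolumn : s.var side.column = x)
    (hwidth : s.var side.width = w) :
    (∀ i ∈ side.rows m A,
      ((copyColumn side).run s).rarr side.target (i.count (side.Mem A)) w = M i x) ∧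
    ∀ i, ∀ j ≠ w, ((copyColumn side).run s).rarr side.target i j = s.rarr side.target i j := by
  have h₀ := h.setVar (x := height) (by decide) 0
  have key := h₀.loop_rows (c := row) (p := copyEntry side) (fun k s' =>
    s'.var height = k.count (side.Mem A) ∧
    (∀ i < k, side.Mem A i → s'.rarr side.target (i.count (side.Mem A)) w = M i x) ∧
    ∀ i, ∀ j ≠ w, s'.rarr side.target i j = s.rarr side.target i j)
    (by cases side <;> decide) (by simp)
    fun k _ s' hF h' hc ⟨hheight, hcopied, hkept⟩ => ?_
  · exact ⟨fun i hi => ((Side.mem_rows h.subset side).1 hi).elim (key.2.1 i), key.2.2⟩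
  have hcolumn' : s'.var side.column = x := by
    cases side <;> exact (hF.var (by decide)).trans hcolumn
  have hwidth' : s'.var side.width = w := by
    cases side <;> exact (hF.var (by decide)).trans hwidth
  have htest := h'.holds_test side
  rw [hc] at htest
  rw [copyEntry, run_ite, Nat.forall_lt_succ_right, Nat.count_succ]
  by_cases hk : side.Mem A k
  · rw [if_pos (htest.2 hk), if_pos hk]
    refine ⟨by simp [hheight], ⟨fun i hi hiA => ?_, fun _ => ?_⟩, fun i j hj => ?_⟩
    · simpa [hheight, (Nat.count_strict_mono hiA hi).ne] using hcopied i hi hiA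
    · simp [hheight, hwidth', h'.eval_entry, hc, hcolumn']
    · simpa [hwidth', hj] using hkept i j hj
  · rw [if_neg (htest.not.2 hk), if_neg hk]
    exact ⟨by simpa using hheight, ⟨by simpa using hcopied, fun hk' => absurd hk' hk⟩,
      by simpa using hkept⟩

/-- Copies the column in hand if the number of previous columns that agree with it is a multiple
of `step`. -/
def selectStep : Code :=
  .seq (residue side) <| .ite (.neq (.var rem) (.const 0))
    (.seq (copyColumn side) <| .seq (.set side.width (.add (.var side.width) (.const 1)))
      (.set total (.add (.var total) (.var step)))) .skip

/-- Copies one in `step` columns of each class into the factor; `total` becomes the number of the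
copied columns multiplied by `step`. -/
def select : Code :=
  .seq (.set side.width (.const 0)) <| .seq (.set total (.const 0)) <|
    .loop side.column 1 (selectStep side)

/-- The memory after the columns with index below `k` have been treated by `select`. -/
structure State.HasSelected (s : State) (M : Matrix ℕ ℕ ℝ) (m : ℕ) (A : Finset ℕ) (d k : ℕ) :
    Prop where
  var_width : s.var side.width = k.count (Selected (colPart M (side.rows m A)) d)
  var_total : s.var total = k.count (Selected (colPart M (side.rows m A)) d) * d
  rarr_target : ∀ x < k, Selected (colPart M (side.rows m A)) d x → ∀ i ∈ side.rows m A,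
    s.rarr side.target (i.count (side.Mem A))
      (x.count (Selected (colPart M (side.rows m A)) d)) = M i x

theorem selectStep_run {d k : ℕ} (h : s.Stores M m n A) (hb : s.var bound = m) (hd : 0 < d)
    (hstep : s.var step = d) (hk : k < n) (hcolumn : s.var side.column = k)
    (hs : s.HasSelected side M m A d k) :
    ((selectStep side).run s).HasSelected side M m A d (k + 1) := by
  have hF := agreeOff_run (residue side) s
  have h' := h.of_agreeOff hF (by cases side <;> decide)
  have hrem : (Test.neq (.var rem) (.const 0)).Holds ((residue side).run s) ↔
      Selected (colPart M (side.rows m A)) d k := by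
    rw [Test.Holds, NExp.eval, NExp.eval, residue_run side h hb (hstep ▸ hd) hcolumn hk, hstep,
      ← Nat.dvd_iff_mod_eq_zero, Selected]
  have hcolumn' := (hF.var (by cases side <;> decide)).trans hcolumn
  have hwidth := (hF.var (by cases side <;> decide)).trans hs.var_width
  have htotal := (hF.var (by cases side <;> decide)).trans hs.var_total
  have hstep' := (hF.var (by cases side <;> decide)).trans hstep
  have htarget : ((residue side).run s).rarr side.target = s.rarr side.target :=
    hF.rarr (by cases side <;> decide)
  rw [selectStep, run_seq, run_ite]
  by_cases hsel : Selected (colPart M (side.rows m A)) d k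
  · obtain ⟨hcopied, hkept⟩ := copyColumn_run side h' hcolumn' hwidth
    have hF' := agreeOff_run (copyColumn side) ((residue side).run s)
    replace hwidth := (hF'.var (by cases side <;> decide)).trans hwidth
    replace htotal := (hF'.var (by cases side <;> decide)).trans htotal
    replace hstep' := (hF'.var (by cases side <;> decide)).trans hstep'
    rw [if_pos (hrem.2 hsel)]
    refine ⟨?_, ?_, Nat.forall_lt_succ_right.2 ⟨fun x hx hselx i hi => ?_, fun _ i hi => ?_⟩⟩
    · cases side <;> simpa [Side.width, Nat.count_succ, hsel] using hwidth
    · cases side <;> simp [Side.width, Nat.count_succ, hsel, htotal, hstep', add_mul]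
    · rw [htarget] at hkept
      simpa [hkept _ _ (Nat.count_strict_mono hselx hx).ne] using hs.rarr_target x hx hselx i hi
    · simpa using hcopied i hi
  · rw [if_neg (hrem.not.2 hsel)]
    refine ⟨?_, ?_, Nat.forall_lt_succ_right.2 ⟨fun x hx hselx i hi => ?_, fun h => absurd h hsel⟩⟩
    · simpa [Nat.count_succ, hsel] using hwidth
    · simpa [Nat.count_succ, hsel] using htotal
    · simpa [htarget] using hs.rarr_target x hx hselx i hi

theorem select_run_hasSelected {d : ℕ} (h : s.Stores M m n A) (hb : s.var bound = m) (hd : 0 < d)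
    (hstep : s.var step = d) : ((select side).run s).HasSelected side M m A d n := by
  have hwidth : Reg.cols < side.width := by cases side <;> decide
  have h₀ := (h.setVar hwidth 0).setVar (x := total) (by decide) 0
  refine h₀.loop_cols (c := side.column) (p := selectStep side)
    (fun k s' => s'.HasSelected side M m A d k) (by cases side <;> decide)
    ⟨?_, ?_, ?_⟩ fun k hk s' hF h' hc hs => ?_
  · cases side <;> simp [Side.width, Side.column]
  · cases side <;> simp [Side.width, Side.column]
  · simp
  · have hbound : s'.var bound = m := by
      cases side <;> exact (hF.var (by decide)).trans hb
    have hstep' : s'.var step = d := by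
      cases side <;> exact (hF.var (by decide)).trans hstep
    have hs' := selectStep_run side h' hbound hd hstep' hk hc hs
    refine ⟨?_, ?_, hs'.rarr_target⟩
    · rw [← hs'.var_width]
      cases side <;> rfl
    · rw [← hs'.var_total]
      cases side <;> rfl

theorem select_run {d : ℕ} (h : s.Stores M m n A) (hb : s.var bound = m) (hd : 0 < d)
    (hstep : s.var step = d) :
    ((select side).run s).var total = ((select side).run s).var side.width * d ∧
    (((select side).run s).var total = n ↔
      ∀ z, d ∣ colCount M (range n) (side.rows m A) z) ∧
    (((select side).run s).var total = n →
      IsThinning ((Matrix.of (((select side).run s).rarr side.target)).submatrix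
          (Nat.count (side.Mem A)) id) (range (((select side).run s).var side.width))
        M (range n) (side.rows m A) d) := by
  obtain ⟨hwidth, htotal, htarget⟩ := select_run_hasSelected side h hb hd hstep
  rw [hwidth, htotal]
  exact ⟨rfl, count_selected_colPart_mul_eq_iff hd,
    fun hcount => isThinning_of_selected hd hcount htarget⟩

end

/-- The memory holds two factors of the matrix `M`, for the marked and the unmarked rows. -/
def State.HasFactors (s : State) (M : Matrix ℕ ℕ ℝ) (m n : ℕ) (A : Finset ℕ) : Prop :=
  ∃ d, d * s.var width₁ = n ∧ s.var width₂ * s.var width₁ = n ∧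
    IsThinning ((Matrix.of (s.rarr 1)).submatrix (Nat.count (· ∈ A)) id) (range (s.var width₁))
      M (range n) A d ∧
    IsThinning ((Matrix.of (s.rarr 2)).submatrix (Nat.count (· ∉ A)) id) (range (s.var width₂))
      M (range n) (range m \ A) (s.var width₁)

/-- Tries to complement the factor for the marked rows by a factor for the unmarked rows. -/
def attemptSecond : Code :=
  .seq (.set step (.var width₁)) <| .seq (select .unmarked) <|
    .ite (.neq (.var total) (.var cols)) (.set found (.const 1)) .skip

theorem attemptSecond_run {d : ℕ} (h : s.Stores M m n A) (hb : s.var bound = m)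
    (hfound : s.var found = 0) (hwidth : 0 < s.var width₁) (hd : d * s.var width₁ = n)
    (hthin : IsThinning ((Matrix.of (s.rarr 1)).submatrix (Nat.count (· ∈ A)) id)
      (range (s.var width₁)) M (range n) A d) :
    (attemptSecond.run s).var found = 1 ∧ (attemptSecond.run s).HasFactors M m n A ∨
    (attemptSecond.run s).var found = 0 ∧
      ¬ ∀ z, s.var width₁ ∣ colCount M (range n) (range m \ A) z := by
  have h₁ := h.setVar (x := step) (by decide) (s.var width₁)
  obtain ⟨htotal, hdvd, hthin₂⟩ := select_run .unmarked h₁ hb hwidth rfl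
  have hF := agreeOff_run (select .unmarked) (s.setVar step (s.var width₁))
  rw [attemptSecond, run_seq, run_seq, run_ite, run_set, NExp.eval]
  set t := (select .unmarked).run (s.setVar step (s.var width₁))
  have h₂ : t.Stores M m n A := h₁.of_agreeOff hF (by decide)
  have hwidth₁ : t.var width₁ = s.var width₁ := hF.var (by decide)
  have hrarr : t.rarr 1 = s.rarr 1 := hF.rarr (by decide)
  have hcount : (Test.neq (.var total) (.var cols)).Holds t ↔ t.var total = n := by
    rw [Test.Holds, NExp.eval, NExp.eval, h₂.var_cols]
  by_cases htn : t.var total = n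
  · rw [if_pos (hcount.2 htn)]
    refine .inl ⟨rfl, d, ?_⟩
    simp only [run_set, State.setVar_var, State.setVar_rarr]
    exact ⟨hwidth₁ ▸ hd, hwidth₁ ▸ htotal ▸ htn, hrarr ▸ hwidth₁ ▸ hthin, hwidth₁ ▸ hthin₂ htn⟩
  · rw [if_neg (hcount.not.2 htn)]
    exact .inr ⟨(hF.var (by decide)).trans hfound, hdvd.not.1 htn⟩

/-- Tries to find factors the first of which arises from the matrix by copying one in `trial + 1`
columns of each class. -/
def attempt : Code :=
  .seq (.set step (.add (.var trial) (.const 1))) <| .seq (select .marked) <|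
    .ite (.neq (.var total) (.var cols)) attemptSecond .skip

theorem attempt_run (h : s.Stores M m n A) (hb : s.var bound = m) (hn : 0 < n)
    (hfound : s.var found = 0) :
    (attempt.run s).var found = 1 ∧ (attempt.run s).HasFactors M m n A ∨
    (attempt.run s).var found = 0 ∧ ¬ ∃ e, (s.var trial + 1) * e = n ∧
      (∀ z, s.var trial + 1 ∣ colCount M (range n) A z) ∧
      ∀ z, e ∣ colCount M (range n) (range m \ A) z := by
  have h₁ := h.setVar (x := step) (by decide) (s.var trial + 1)
  obtain ⟨htotal, hdvd, hthin⟩ := select_run .marked h₁ hb (Nat.succ_pos _) rfl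
  have hF := agreeOff_run (select .marked) (s.setVar step (s.var trial + 1))
  rw [attempt, run_seq, run_seq, run_ite, run_set, NExp.eval, NExp.eval, NExp.eval]
  set t := (select .marked).run (s.setVar step (s.var trial + 1))
  have h₂ : t.Stores M m n A := h₁.of_agreeOff hF (by decide)
  have hfound' : t.var found = 0 := (hF.var (by decide)).trans hfound
  have hcount : (Test.neq (.var total) (.var cols)).Holds t ↔ t.var total = n := by
    rw [Test.Holds, NExp.eval, NExp.eval, h₂.var_cols]
  by_cases htn : t.var total = n
  · have hmul : (s.var trial + 1) * t.var width₁ = n := by rw [mul_comm, ← htn]; exact htotal.symm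
    have hpos : 0 < t.var width₁ := Nat.pos_of_ne_zero fun h0 => by simp [h0, hn.ne] at hmul
    rw [if_pos (hcount.2 htn)]
    refine (attemptSecond_run h₂ ((hF.var (by decide)).trans hb) hfound' hpos hmul
      (hthin htn)).imp_right (And.imp_right fun hnot => ?_)
    rintro ⟨e, he, -, hdvd₂⟩
    exact hnot (Nat.eq_of_mul_eq_mul_left (Nat.succ_pos _) (he.trans hmul.symm) ▸ hdvd₂)
  · rw [if_neg (hcount.not.2 htn)]
    exact .inr ⟨hfound', fun ⟨_, _, hdvd₁, _⟩ => htn (hdvd.2 hdvd₁)⟩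

/-- Attempts to find factors unless this has already been successful. -/
def searchStep : Code := .ite (.neq (.var found) (.const 0)) attempt .skip

/-- Searches for factors for the marked and the unmarked rows. -/
def search : Code := .loop trial 1 searchStep

theorem search_run (h : s.Stores M m n A) (hb : s.var bound = m) (hn : 0 < n)
    (hfound : s.var found = 0)
    (hde : ∃ d e, d * e = n ∧ (∀ z, d ∣ colCount M (range n) A z) ∧
      ∀ z, e ∣ colCount M (range n) (range m \ A) z) :
    (search.run s).var found = 1 ∧ (search.run s).HasFactors M m n A := by
  have key := h.loop_cols (c := trial) (p := searchStep) (fun k s' =>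
    s'.var found = 1 ∧ s'.HasFactors M m n A ∨
    s'.var found = 0 ∧ ∀ d < k, ¬ ∃ e, (d + 1) * e = n ∧
      (∀ z, d + 1 ∣ colCount M (range n) A z) ∧ ∀ z, e ∣ colCount M (range n) (range m \ A) z)
    (by decide) (.inr ⟨hfound, by simp⟩) fun k _ s' hF h' hc ih => ?_
  · obtain ⟨d, e, rfl, hdvd⟩ := hde
    refine key.resolve_right fun hnone => hnone.2 (d - 1) ?_ ⟨e, ?_⟩
    · exact (Nat.pred_lt (Nat.pos_of_mul_pos_right hn).ne').trans_le
        (Nat.le_mul_of_pos_right _ (Nat.pos_of_mul_pos_left hn))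
    · rw [Nat.sub_add_cancel (Nat.pos_of_mul_pos_right hn)]
      exact ⟨rfl, hdvd⟩
  · rw [searchStep, run_ite]
    obtain ⟨hfound', hfactors⟩ | ⟨hfound', hnone⟩ := ih
    · rw [if_neg (by simp [hfound'])]
      exact .inl ⟨hfound', hfactors⟩
    · rw [if_pos (by simpa using hfound')]
      have hrun := attempt_run h' ((hF.var (by decide)).trans hb) hn hfound'
      rw [hc] at hrun
      exact hrun.imp_right (And.imp_right fun hk => Nat.forall_lt_succ_right.2 ⟨hnone, hk⟩)

/-- Counts the row in hand as marked or as unmarked. -/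
def countRow : Code :=
  .ite isMarked (.set height₁ (.add (.var height₁) (.const 1)))
    (.set height₂ (.add (.var height₂) (.const 1)))

/-- Counts the marked and the unmarked rows. -/
def countRows : Code :=
  .seq (.set height₁ (.const 0)) <| .seq (.set height₂ (.const 0)) <| .loop row 0 countRow

theorem countRows_run (h : s.Stores M m n A) :
    (countRows.run s).var height₁ = m.count (· ∈ A) ∧
    (countRows.run s).var height₂ = m.count (· ∉ A) := by
  have h₀ := (h.setVar (x := height₁) (by decide) 0).setVar (x := height₂) (by decide) 0
  refine h₀.loop_rows (c := row) (p := countRow)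
    (fun k s' => s'.var height₁ = k.count (· ∈ A) ∧ s'.var height₂ = k.count (· ∉ A))
    (by decide) (by simp) fun k _ s' _ h' hc ih => ?_
  have hmarked := h'.holds_isMarked
  rw [hc] at hmarked
  by_cases hk : k ∈ A <;> simp [countRow, hmarked, hk, ih, Nat.count_succ]

theorem count_notMem_eq_zero_iff (hA : A ⊆ range m) : m.count (· ∉ A) = 0 ↔ A = range m := by
  rw [Nat.count_iff_forall_not]
  refine ⟨fun h => hA.antisymm fun i hi => not_not.1 (h i (mem_range.1 hi)), ?_⟩
  rintro rfl i hi
  exact not_not.2 (mem_range.2 hi)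

/-- Searches for factors for the marked and the unmarked rows, provided that there are unmarked
rows. -/
def factorize : Code :=
  .seq (.set bound (.var rows)) <| .seq countRows <|
    .ite (.neq (.var height₂) (.const 0)) .skip search

theorem factorize_run (h : s.Stores M m n A) (hfound : s.var found = 0) (hn : 0 < n)
    (hA : SplitsOff M (range n) (range m) A) :
    A = range m ∧ (factorize.run s).var found = 0 ∨
    A ≠ range m ∧ (factorize.run s).var found = 1 ∧
      (factorize.run s).var height₁ = m.count (· ∈ A) ∧
      (factorize.run s).var height₂ = m.count (· ∉ A) ∧
      (factorize.run s).HasFactors M m n A := by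
  have h₁ := h.setVar (x := bound) (by decide) m
  have hF := agreeOff_run countRows (s.setVar bound m)
  obtain ⟨hheight₁, hheight₂⟩ := countRows_run h₁
  rw [factorize, run_seq, run_seq, run_ite, run_set, NExp.eval, h.var_rows]
  set t := countRows.run (s.setVar bound m)
  have h₂ : t.Stores M m n A := h₁.of_agreeOff hF (by decide)
  have hfound' : t.var found = 0 := (hF.var (by decide)).trans hfound
  have hempty : (Test.neq (.var height₂) (.const 0)).Holds t ↔ A = range m := by
    rw [Test.Holds, NExp.eval, NExp.eval, hheight₂, count_notMem_eq_zero_iff hA.1]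
  by_cases hAm : A = range m
  · rw [if_pos (hempty.2 hAm)]
    exact .inl ⟨hAm, hfound'⟩
  · rw [if_neg (hempty.not.2 hAm)]
    have hF' := agreeOff_run search t
    obtain ⟨d, e, hde⟩ := hA.2.exists_mul_eq_card disjoint_sdiff (nonempty_range_iff.2 hn.ne')
    rw [card_range] at hde
    obtain ⟨hfound₁, hfactors⟩ :=
      search_run h₂ (hF.var (by decide)) hn hfound' ⟨d, e, hde⟩
    exact .inr ⟨hAm, hfound₁, (hF'.var (by decide)).trans hheight₁,
      (hF'.var (by decide)).trans hheight₂, hfactors⟩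

theorem State.HasFactors.matIso {S : Matrix (Fin m) (Fin n) ℝ} (h : s.HasFactors M m n A)
    (hM : ∀ (i : Fin m) (j : Fin n), M i j = S i j) (hn : 0 < n)
    (hA : SplitsOff M (range n) (range m) A) :
    0 < s.var width₁ ∧ 0 < s.var width₂ ∧ MatIso S
      (oneProd (s.matrix 1 (m.count (· ∈ A)) (s.var width₁))
        (s.matrix 2 (m.count (· ∉ A)) (s.var width₂))) := by
  obtain ⟨d, hd, hwidth, hthin₁, hthin₂⟩ := h
  refine ⟨?_, ?_, matIso_oneProd_of_isThinning hM hA hn hd hthin₁ hthin₂⟩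
  · exact Nat.pos_of_mul_pos_left (hd ▸ hn)
  · exact Nat.pos_of_mul_pos_right (hwidth ▸ hn)

/-- Decides whether the input is a 1-product and finds two factors in this case. -/
def decompose : Code :=
  .ite (.and (.nle (.const 1) (.var rows)) (.nle (.const 1) (.var cols)))
    (.seq grow factorize) .skip

theorem stores_input (S : Matrix (Fin m) (Fin n) ℝ) :
    (input S).Stores (Matrix.of ((input S).rarr 0)) m n ∅ where
  var_rows := rfl
  var_cols := rfl
  rarr_eq _ _ := rfl
  mem_iff _ := by simp [input]
  subset := empty_subset _

/-- Puts the results of `decompose` where an answer is expected. -/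
def report : Code :=
  .seq (.set 0 (.var found)) <| .seq (.set 1 (.var height₁)) <| .seq (.set 2 (.var width₁)) <|
    .seq (.set 3 (.var height₂)) (.set 4 (.var width₂))

variable {S : Matrix (Fin m) (Fin n) ℝ}

theorem correctAnswer_report_of_not_isOneProduct (hS : ¬ IsOneProduct S)
    (hfound : s.var found = 0) : CorrectAnswer S (report.run s) :=
  ⟨fun _ => hfound, fun hS' => absurd hS' hS⟩

theorem correctAnswer_report_of_matIso (hfound : s.var found = 1)
    (hheight₁ : 0 < s.var height₁) (hwidth₁ : 0 < s.var width₁)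
    (hheight₂ : 0 < s.var height₂) (hwidth₂ : 0 < s.var width₂)
    (hiso : MatIso S (oneProd (s.matrix 1 (s.var height₁) (s.var width₁))
      (s.matrix 2 (s.var height₂) (s.var width₂)))) : CorrectAnswer S (report.run s) :=
  ⟨fun hS => absurd ⟨_, _, _, _, _, _, hheight₁, hwidth₁, hheight₂, hwidth₂, hiso⟩ hS,
    fun _ => ⟨hfound, hheight₁, hwidth₁, hheight₂, hwidth₂, hiso⟩⟩

theorem correctAnswer_run (S : Matrix (Fin m) (Fin n) ℝ) :
    CorrectAnswer S (report.run (decompose.run (input S))) := by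
  have hM (i : Fin m) (j : Fin n) : (input S).rarr 0 i j = S i j := by simp [input]
  have hnonempty : (Test.and (.nle (.const 1) (.var rows)) (.nle (.const 1) (.var cols))).Holds
      (input S) ↔ 0 < m ∧ 0 < n := .rfl
  rw [decompose, run_ite]
  by_cases hpos : 0 < m ∧ 0 < n
  · rw [if_pos (hnonempty.2 hpos), run_seq]
    obtain ⟨A, hA, ⟨h0, hsplits⟩, hleast⟩ := grow_run (stores_input S) hpos.1
    have hfound : (grow.run (input S)).var found = 0 := (agreeOff_run grow _).var (by decide)
    obtain ⟨hAm, hfound₁⟩ | ⟨hAm, hfound₁, hheight₁, hheight₂, hfactors⟩ :=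
      factorize_run hA hfound hpos.2 hsplits
    · refine correctAnswer_report_of_not_isOneProduct (fun hS => ?_) hfound₁
      obtain ⟨Z, hZm, hZ⟩ := hS.exists_splitsOff hM
      exact hZm (hZ.2.1.antisymm (hAm ▸ hleast hZ))
    · obtain ⟨hwidth₁, hwidth₂, hiso⟩ := hfactors.matIso hM hpos.2 hsplits
      rw [← hheight₁, ← hheight₂] at hiso
      refine correctAnswer_report_of_matIso hfound₁ ?_ hwidth₁ ?_ hwidth₂ hiso
      · rw [hheight₁]
        exact Nat.pos_of_ne_zero (Nat.count_ne_iff_exists.2 ⟨0, hpos.1, h0⟩)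
      · rw [hheight₂]
        exact Nat.pos_of_ne_zero ((count_notMem_eq_zero_iff hsplits.1).not.2 hAm)
  · rw [if_neg (hnonempty.not.2 hpos), run_skip]
    exact correctAnswer_report_of_not_isOneProduct (fun hS => hpos hS.pos) rfl

theorem exec_decompose_report (S : Matrix (Fin m) (Fin n) ℝ) :
    ∃ t ≤ MvPolynomial.eval ![m, n] (decompose.time + 10),
      Exec (.seq decompose.compile report.compile) (input S) t
        (report.run (decompose.run (input S))) := by
  obtain ⟨t, ht, hdecompose⟩ := exec_compile decompose (by decide) (by decide) (input S)
  have hreport (s : State) : Exec report.compile s 10 (report.run s) :=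
    .seq (.set _ _ _) (.seq (.set _ _ _) (.seq (.set _ _ _) (.seq (.set _ _ _) (.set _ _ _))))
  have hdims : ![m, n] = (input S).dims := by ext b; fin_cases b <;> rfl
  refine ⟨t + 10, ?_, .seq hdecompose (hreport _)⟩
  rw [hdims, map_add, map_ofNat]
  exact Nat.add_le_add_right ht 10

end RealRAM

theorem theorem1 :
    ∃ (P : RealRAM.Program) (p : MvPolynomial (Fin 2) ℕ),
      ∀ (m n : ℕ) (S : Matrix (Fin m) (Fin n) ℝ),
        ∃ (t : ℕ) (s : RealRAM.State),
          RealRAM.Exec P (RealRAM.input S) t s ∧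
          t ≤ MvPolynomial.eval ![m, n] p ∧
          CorrectAnswer S s := by
  refine ⟨.seq RealRAM.decompose.compile RealRAM.report.compile, RealRAM.decompose.time + 10,
    fun m n S => ?_⟩
  obtain ⟨t, ht, hexec⟩ := RealRAM.exec_decompose_report S
  exact ⟨t, _, hexec, ht, RealRAM.correctAnswer_run S⟩
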